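/- Let $H$ be a real Hilbert space, let $A$ be a strictly positive selfadjoint operator on $H$ (that is, $\langle Au,u\rangle\ge c\|u\|^2$ on its domain for some $c>0$), and let $H^1=D(A^{1/2})$ be the Hilbert space with inner product $\langle u,v\rangle_1=\langle A^{1/2}u,A^{1/2}v\rangle$ and norm $\|u\|_1=\|A^{1/2}u\|$. Let $\gamma\in\mathbb R$ and $0<\delta<\alpha$, and let $g:\mathbb R^+=(0,\infty)\to\mathbb R$ be a nonnull differentiable function such that - $g$ and $g'$ are summable on $\mathbb R^+$ and absolutely continuous on every compact subinterval of $\mathbb R^+$, and $\int_0^\infty g(s)\,ds<\gamma$; - $g(s)\ge 0$ and $g'(s)\le 0$ for every $s>0$; - $(\alpha-\delta)g'(s)-g''(s)\le 0$ for almost every $s>0$. (The weight $-g'$ need not be decreasing.) Let $M=L^2_{-g'}(\mathbb R^+;H^1)$ be the Hilbert space of (classes of) functions $\eta:\mathbb R^+\to H^1$ that are square summable with respect to the measure $-g'(s)\,ds$, with $\|\eta\|_M^2=\int_0^\infty -g'(s)\|\eta(s)\|_1^2\,ds$. Define the operator $T\eta=-\eta'$ with domain $$D(T)=\{\eta\in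 M:\ \eta'\in M,\ \eta(0)=0\},$$ where $\eta'$ is the weak derivative of $\eta$ on the open set $\{s>0: g'(s)<0\}$ (which is all of $\mathbb R^+$ if $g'$ never vanishes), and $\eta(0)$ is the limit in $H^1$, as $s\to0^+$, of the continuous representative of $\eta$ on this set. For $t\ge 0$ let $$[R(t)\eta](s)=\begin{cases}0, & s\le t,\\ \eta(s-t), & s>t.\end{cases}$$ Then $R(t)$ is a well-defined bounded linear operator on $M$ for every $t\ge0$, the family $(R(t))_{t\ge 0}$ is a strongly continuous semigroup on $M$, and its infinitesimal generator is exactly the operator $T$ (equality of domains and of values). In particular, $\big(e^{-(\alpha-\delta)t/2}R(t)\big)_{t\ge0}$ is a strongly continuous semigroup of contractions on $M$. -/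

import Mathlib

open Set Filter MeasureTheory
open scoped Topology NNReal ENNReal ContDiff RealInnerProductSpace

noncomputable section

/-! ### The energy space `H¹ = D(A^{1/2})` -/

section EnergySpace

variable {H : Type*} [NormedAddCommGroup H] [InnerProductSpace ℝ H] [CompleteSpace H]

/-- `A` is a strictly positive (possibly unbounded) selfadjoint operator on `H`. Mathlib's
`IsSelfAdjoint` forces the domain to be dense. -/
structure IsStrictlyPositiveOperator (A : H →ₗ.[ℝ] H) : Prop where
  selfAdjoint : IsSelfAdjoint A
  coercive : ∃ c : ℝ, 0 < c ∧ ∀ x : A.domain, c * ‖(x : H)‖ ^ 2 ≤ ⟪A x, (x : H)⟫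

/-- `B = A^{1/2}`: the operator `B` is selfadjoint and nonnegative, and `B² = A`, the domain of
`B²` being the set of all `x` in the domain of `B` with `B x` in the domain of `B`.
(These properties characterize the square root of a nonnegative selfadjoint operator.) -/
structure IsPositiveSqrt (A B : H →ₗ.[ℝ] H) : Prop where
  selfAdjoint : IsSelfAdjoint B
  nonneg : ∀ x : B.domain, 0 ≤ ⟪B x, (x : H)⟫
  sq_eq : ∀ x y : H, (x, y) ∈ A.graph ↔ ∃ z : H, (x, z) ∈ B.graph ∧ (z, y) ∈ B.graph

theorem IsStrictlyPositiveOperator.surjective {A : H →ₗ.[ℝ] H}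
    (hA : IsStrictlyPositiveOperator A) : Function.Surjective A := by
  obtain ⟨c, hc, hpos⟩ := hA.coercive
  have hbd : ∀ x : A.domain, c * ‖(x : H)‖ ≤ ‖A x‖ := by
    intro x
    rcases eq_or_lt_of_le (norm_nonneg (x : H)) with h | h
    · rw [← h]; simp
    · have h1 := hpos x
      have h2 := real_inner_le_norm (A x) (x : H)
      have h3 : (c * ‖(x : H)‖) * ‖(x : H)‖ ≤ ‖A x‖ * ‖(x : H)‖ := by nlinarith
      exact le_of_mul_le_mul_right h3 h
  have hclosed : IsClosed (LinearMap.range A.toFun : Set H) := by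
    refine IsSeqClosed.isClosed ?_
    intro y y₀ hy hlim
    choose x hx using fun n => hy n
    have hx' : ∀ n, A (x n) = y n := hx
    have hcau : CauchySeq (fun n => ((x n : A.domain) : H)) := by
      rw [Metric.cauchySeq_iff']
      intro ε hε
      obtain ⟨N, hN⟩ := Metric.cauchySeq_iff'.1 hlim.cauchySeq (c * ε) (by positivity)
      refine ⟨N, fun n hn => ?_⟩
      have h1 := hbd (x n - x N)
      rw [LinearPMap.map_sub, hx', hx'] at h1
      have h2 := hN n hn
      rw [dist_eq_norm] at h2 ⊢
      have h3 : c * ‖((x n : A.domain) : H) - (x N : H)‖ < c * ε := lt_of_le_of_lt h1 h2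
      exact lt_of_mul_lt_mul_left h3 hc.le
    obtain ⟨x₀, hx₀⟩ := cauchySeq_tendsto_of_complete hcau
    have hg : (x₀, y₀) ∈ (A.graph : Set (H × H)) := by
      refine hA.selfAdjoint.isClosed.mem_of_tendsto (hx₀.prodMk_nhds hlim)
        (Eventually.of_forall fun n => ?_)
      rw [← hx' n]
      exact A.mem_graph (x n)
    obtain ⟨x', -, hx'⟩ := (LinearPMap.mem_graph_iff A).1 hg
    exact ⟨x', hx'⟩
  have horth : (LinearMap.range A.toFun)ᗮ = ⊥ := by
    rw [Submodule.eq_bot_iff]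
    intro y hy
    have h0 : ∀ x : A.domain, ⟪(0 : H), (x : H)⟫ = ⟪y, A x⟫ := by
      intro x
      rw [inner_zero_left]
      exact ((Submodule.mem_orthogonal' _ _).1 hy _ ⟨x, rfl⟩).symm
    have hsa : A.adjoint = A := LinearPMap.isSelfAdjoint_def.1 hA.selfAdjoint
    have hmem : y ∈ A.adjoint.domain := LinearPMap.mem_adjoint_domain_of_exists y ⟨0, h0⟩
    have hval := LinearPMap.adjoint_apply_eq hA.selfAdjoint.dense_domain ⟨y, hmem⟩ h0
    have hgr : (y, (0 : H)) ∈ A.graph := by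
      rw [← congrArg LinearPMap.graph hsa, LinearPMap.mem_graph_iff]
      exact ⟨⟨y, hmem⟩, rfl, hval⟩
    obtain ⟨x, hx1, hx2⟩ := (LinearPMap.mem_graph_iff A).1 hgr
    have := hbd x
    simp only at hx1 hx2
    rw [hx2, norm_zero, hx1] at this
    have h4 : ‖y‖ = 0 := le_antisymm (by nlinarith) (norm_nonneg y)
    exact norm_eq_zero.1 h4
  have htop : LinearMap.range A.toFun = ⊤ := by
    have : CompleteSpace (LinearMap.range A.toFun) := hclosed.completeSpace_coe
    exact Submodule.orthogonal_eq_bot_iff.1 horth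
  exact LinearMap.range_eq_top.1 htop

theorem IsPositiveSqrt.surjective {A B : H →ₗ.[ℝ] H} (hA : IsStrictlyPositiveOperator A)
    (hB : IsPositiveSqrt A B) : Function.Surjective B := by
  intro y
  obtain ⟨x, hx⟩ := hA.surjective y
  obtain ⟨z, -, hz⟩ := (hB.sq_eq x y).1 (hx ▸ A.mem_graph x)
  obtain ⟨w, -, hw⟩ := (LinearPMap.mem_graph_iff B).1 hz
  exact ⟨w, hw⟩

theorem IsPositiveSqrt.eq_zero {A B : H →ₗ.[ℝ] H} (hA : IsStrictlyPositiveOperator A)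
    (hB : IsPositiveSqrt A B) (x : B.domain) (hx : B x = 0) : x = 0 := by
  have hsym : ∀ u v : B.domain, ⟪B u, (v : H)⟫ = ⟪(u : H), B v⟫ := by
    have h := LinearPMap.adjoint_isFormalAdjoint hB.selfAdjoint.dense_domain
    rw [LinearPMap.isSelfAdjoint_def.1 hB.selfAdjoint] at h
    exact h
  obtain ⟨v, hv⟩ := hB.surjective hA (x : H)
  have h := hsym x v
  rw [hx, hv, inner_zero_left] at h
  exact Subtype.ext (inner_self_eq_zero.1 h.symm)

/-- The space `H¹`: the domain of `B = A^{1/2}`, carrying the inner product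
`⟪u, v⟫₁ = ⟪B u, B v⟫` and the norm `‖u‖₁ = ‖B u‖` (and not those inherited from `H`). -/
def EnergySpace {A B : H →ₗ.[ℝ] H} (_hA : IsStrictlyPositiveOperator A)
    (_hB : IsPositiveSqrt A B) : Type _ := B.domain

namespace EnergySpace

variable {A B : H →ₗ.[ℝ] H} (hA : IsStrictlyPositiveOperator A) (hB : IsPositiveSqrt A B)

instance : AddCommGroup (EnergySpace hA hB) := inferInstanceAs (AddCommGroup B.domain)

instance : Module ℝ (EnergySpace hA hB) := inferInstanceAs (Module ℝ B.domain)

/-- `A^{1/2}` as a linear map from `H¹` to `H`. -/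
def sqrtMap : EnergySpace hA hB →ₗ[ℝ] H := B.toFun

instance core : InnerProductSpace.Core ℝ (EnergySpace hA hB) where
  inner u v := ⟪sqrtMap hA hB u, sqrtMap hA hB v⟫
  conj_inner_symm u v := by simp [real_inner_comm]
  re_inner_nonneg u := by simp
  add_left u v w := by simp [inner_add_left]
  smul_left u v r := by simp [inner_smul_left]
  definite u hu := hB.eq_zero hA u (inner_self_eq_zero.1 hu)

instance : NormedAddCommGroup (EnergySpace hA hB) :=
  InnerProductSpace.Core.toNormedAddCommGroup (𝕜 := ℝ)

instance : InnerProductSpace ℝ (EnergySpace hA hB) := InnerProductSpace.ofCore _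

theorem inner_eq (u v : EnergySpace hA hB) : ⟪u, v⟫ = ⟪sqrtMap hA hB u, sqrtMap hA hB v⟫ := rfl

theorem norm_eq (u : EnergySpace hA hB) : ‖u‖ = ‖sqrtMap hA hB u‖ := by
  rw [norm_eq_sqrt_real_inner, norm_eq_sqrt_real_inner, inner_eq]

instance : CompleteSpace (EnergySpace hA hB) := by
  let e : EnergySpace hA hB →ₗᵢ[ℝ] H := ⟨sqrtMap hA hB, fun u => (norm_eq hA hB u).symm⟩
  have hs : Function.Surjective e := hB.surjective hA
  exact (LinearIsometryEquiv.ofSurjective e hs).toIsometryEquiv.completeSpace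

end EnergySpace

end EnergySpace

/-! ### The memory kernel and the memory space -/

/-- Absolute continuity on every compact subinterval of `(0, ∞)`. -/
def LocallyAC (f : ℝ → ℝ) : Prop :=
  ∀ a b : ℝ, 0 < a → a ≤ b → AbsolutelyContinuousOnInterval f a b

/-- The assumptions on the memory kernel `g`, of which only the values on `(0, ∞)` matter.
The function `g` is differentiable at every point of `(0, ∞)`, with derivative `deriv g`, while
`deriv (deriv g)` is the almost everywhere defined second derivative. -/
structure IsMemoryKernel (g : ℝ → ℝ) (α γ δ : ℝ) : Prop where
  nonnull : ∃ s, 0 < s ∧ g s ≠ 0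
  differentiable : ∀ s, 0 < s → DifferentiableAt ℝ g s
  integrable : IntegrableOn g (Ioi 0)
  integrable_deriv : IntegrableOn (deriv g) (Ioi 0)
  locallyAC : LocallyAC g
  locallyAC_deriv : LocallyAC (deriv g)
  mass_lt : ∫ s in Ioi 0, g s < γ
  nonneg : ∀ s, 0 < s → 0 ≤ g s
  deriv_nonpos : ∀ s, 0 < s → deriv g s ≤ 0
  delta_pos : 0 < δ
  delta_lt : δ < α
  deriv_deriv : ∀ᵐ s : ℝ, 0 < s → (α - δ) * deriv g s - deriv (deriv g) s ≤ 0

/-- The measure `-g'(s) ds` on `(0, ∞)`. -/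
def memoryMeasure (g : ℝ → ℝ) : Measure ℝ :=
  (volume.restrict (Ioi 0)).withDensity fun s => ENNReal.ofReal (-deriv g s)

/-- The memory space `M = L²_{-g'}(ℝ⁺; V)`, with its Hilbert space structure
`⟪η₁, η₂⟫ = ∫ -g'(s) ⟪η₁(s), η₂(s)⟫ ds`. -/
abbrev MemorySpace (g : ℝ → ℝ) (V : Type*) [NormedAddCommGroup V] : Type _ :=
  Lp V 2 (memoryMeasure g)

/-- The set of all `s > 0` where the weight `-g'` is positive. An element of the memory space is
a function on this set, up to equality almost everywhere; if `g' < 0` on `(0, ∞)`, this set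
is all of `(0, ∞)`. -/
def positivitySet (g : ℝ → ℝ) : Set ℝ := {s | 0 < s ∧ deriv g s < 0}

theorem ae_memoryMeasure_iff (g : ℝ → ℝ) (p : ℝ → Prop) :
    (∀ᵐ s ∂memoryMeasure g, p s) ↔ ∀ᵐ s : ℝ, s ∈ positivitySet g → p s := by
  have hm : Measurable fun s => ENNReal.ofReal (-deriv g s) :=
    (measurable_deriv g).neg.ennreal_ofReal
  rw [memoryMeasure, ae_withDensity_iff hm, ae_restrict_iff' measurableSet_Ioi]
  refine eventually_congr (Eventually.of_forall fun s => ?_)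
  simp only [positivitySet, mem_Ioi, mem_ofPred_eq, ne_eq, ENNReal.ofReal_eq_zero, not_le,
    neg_pos, and_imp]

section Operators

variable {V : Type*} [NormedAddCommGroup V] [InnerProductSpace ℝ V]

/-- `f'` is the weak derivative of `f` on the open set `U ⊆ ℝ`: both are locally integrable on
`U`, and `∫ φ' f = -∫ φ f'` for every smooth `φ` with compact support in `U`. -/
structure HasWeakDerivOn (f f' : ℝ → V) (U : Set ℝ) : Prop where
  locallyIntegrable : LocallyIntegrableOn f U
  locallyIntegrable' : LocallyIntegrableOn f' U
  integral_eq : ∀ φ : ℝ → ℝ, ContDiff ℝ ∞ φ → HasCompactSupport φ → tsupport φ ⊆ U →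
    ∫ s, deriv φ s • f s = -∫ s, φ s • f' s

theorem integrable_smul_of_tsupport_subset {f : ℝ → V} {U : Set ℝ} (hf : LocallyIntegrableOn f U)
    {φ : ℝ → ℝ} (hφ : Continuous φ) (hc : HasCompactSupport φ) (hU : tsupport φ ⊆ U) :
    Integrable fun s => φ s • f s := by
  have h1 : IntegrableOn f (tsupport φ) := hf.integrableOn_compact_subset hU hc
  have h2 : IntegrableOn (fun s => φ s • f s) (tsupport φ) :=
    h1.continuousOn_smul hφ.continuousOn hc
  refine (integrableOn_iff_integrable_of_support_subset fun s hs => ?_).1 h2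
  refine subset_tsupport φ fun h => hs ?_
  simp [h]

theorem integrable_deriv_smul_of_tsupport_subset {f : ℝ → V} {U : Set ℝ}
    (hf : LocallyIntegrableOn f U) {φ : ℝ → ℝ} (hφ : ContDiff ℝ ∞ φ) (hc : HasCompactSupport φ)
    (hU : tsupport φ ⊆ U) : Integrable fun s => deriv φ s • f s := by
  refine integrable_smul_of_tsupport_subset hf (hφ.continuous_deriv (by simp)) hc.deriv ?_
  exact (closure_mono (support_deriv_subset (f := φ))).trans
    (by rw [(isClosed_tsupport φ).closure_eq]; exact hU)

theorem HasWeakDerivOn.add {f₁ f₁' f₂ f₂' : ℝ → V} {U : Set ℝ} (h₁ : HasWeakDerivOn f₁ f₁' U)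
    (h₂ : HasWeakDerivOn f₂ f₂' U) :
    HasWeakDerivOn (fun s => f₁ s + f₂ s) (fun s => f₁' s + f₂' s) U where
  locallyIntegrable := h₁.locallyIntegrable.add h₂.locallyIntegrable
  locallyIntegrable' := h₁.locallyIntegrable'.add h₂.locallyIntegrable'
  integral_eq φ hφ hc hU := by
    simp only [smul_add]
    rw [integral_add (integrable_deriv_smul_of_tsupport_subset h₁.locallyIntegrable hφ hc hU)
      (integrable_deriv_smul_of_tsupport_subset h₂.locallyIntegrable hφ hc hU),
      integral_add (integrable_smul_of_tsupport_subset h₁.locallyIntegrable' hφ.continuous hc hU)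
      (integrable_smul_of_tsupport_subset h₂.locallyIntegrable' hφ.continuous hc hU),
      h₁.integral_eq φ hφ hc hU, h₂.integral_eq φ hφ hc hU, neg_add]

theorem HasWeakDerivOn.const_smul {f f' : ℝ → V} {U : Set ℝ} (h : HasWeakDerivOn f f' U)
    (c : ℝ) : HasWeakDerivOn (fun s => c • f s) (fun s => c • f' s) U where
  locallyIntegrable := h.locallyIntegrable.smul c
  locallyIntegrable' := h.locallyIntegrable'.smul c
  integral_eq φ hφ hc hU := by
    simp only [smul_comm _ c]
    rw [integral_smul, integral_smul, h.integral_eq φ hφ hc hU, smul_neg]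

/-- The graph of the operator `T η = -η'` with domain `{η ∈ M : η' ∈ M, η(0) = 0}`. A pair
`(η, ζ)` belongs to it when `η` has a continuous representative `f` with `f(s) → 0` in `V` as
`s → 0⁺` and with a weak derivative `f'` such that `-f'` represents `ζ`. -/
def translationGraph (g : ℝ → ℝ) (V : Type*) [NormedAddCommGroup V] [InnerProductSpace ℝ V] :
    Submodule ℝ (MemorySpace g V × MemorySpace g V) where
  carrier := {p | ∃ f f' : ℝ → V,
    f =ᵐ[memoryMeasure g] p.1 ∧ (fun s => -f' s) =ᵐ[memoryMeasure g] p.2 ∧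
    HasWeakDerivOn f f' (positivitySet g) ∧ ContinuousOn f (positivitySet g) ∧
    Tendsto f (𝓝[>] 0) (𝓝 0)}
  zero_mem' := by
    refine ⟨fun _ => 0, fun _ => 0, ?_, ?_, ⟨?_, ?_, ?_⟩, continuousOn_const, tendsto_const_nhds⟩
    · filter_upwards [Lp.coeFn_zero V 2 (memoryMeasure g)] with s hs
      exact hs.symm
    · filter_upwards [Lp.coeFn_zero V 2 (memoryMeasure g)] with s hs
      simpa using hs.symm
    · exact locallyIntegrableOn_zero
    · exact locallyIntegrableOn_zero
    · intro φ _ _ _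
      simp
  add_mem' := by
    rintro p q ⟨f₁, f₁', h1, h2, h3, h4, h5⟩ ⟨f₂, f₂', k1, k2, k3, k4, k5⟩
    refine ⟨fun s => f₁ s + f₂ s, fun s => f₁' s + f₂' s, ?_, ?_, h3.add k3, h4.add k4, ?_⟩
    · filter_upwards [h1, k1, Lp.coeFn_add p.1 q.1] with s a b c
      rw [Prod.fst_add, c, Pi.add_apply, a, b]
    · filter_upwards [h2, k2, Lp.coeFn_add p.2 q.2] with s a b c
      rw [Prod.snd_add, c, Pi.add_apply, ← a, ← b, neg_add]
    · simpa using h5.add k5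
  smul_mem' := by
    rintro c p ⟨f, f', h1, h2, h3, h4, h5⟩
    refine ⟨fun s => c • f s, fun s => c • f' s, ?_, ?_, h3.const_smul c, h4.const_smul c, ?_⟩
    · filter_upwards [h1, Lp.coeFn_smul c p.1] with s a b
      rw [Prod.smul_fst, b, Pi.smul_apply, a]
    · filter_upwards [h2, Lp.coeFn_smul c p.2] with s a b
      rw [Prod.smul_snd, b, Pi.smul_apply, ← a, smul_neg]
    · simpa using h5.const_smul c

/-- The operator `T η = -η'` on the memory space, with domain `{η ∈ M : η' ∈ M, η(0) = 0}`. -/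
def translationOperator (g : ℝ → ℝ) (V : Type*) [NormedAddCommGroup V] [InnerProductSpace ℝ V] :
    MemorySpace g V →ₗ.[ℝ] MemorySpace g V :=
  (translationGraph g V).toLinearPMap

theorem LocallyAC.continuousAt {f : ℝ → ℝ} (hf : LocallyAC f) {s : ℝ} (hs : 0 < s) :
    ContinuousAt f s := by
  have h := (hf (s / 2) (2 * s) (by positivity) (by linarith)).continuousOn
  rw [uIcc_of_le (by linarith)] at h
  exact h.continuousAt (Icc_mem_nhds (by linarith) (by linarith))

theorem IsMemoryKernel.isOpen_positivitySet {g : ℝ → ℝ} {α γ δ : ℝ}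
    (hg : IsMemoryKernel g α γ δ) : IsOpen (positivitySet g) := by
  rw [isOpen_iff_mem_nhds]
  rintro s ⟨hs, hs'⟩
  filter_upwards [Ioi_mem_nhds hs,
    (hg.locallyAC_deriv.continuousAt hs).eventually (Iio_mem_nhds hs')] with r h1 h2
  exact ⟨h1, h2⟩

/-- The graph above is single valued, so that it is the graph of `translationOperator`. -/
theorem graph_translationOperator [CompleteSpace V] {g : ℝ → ℝ} {α γ δ : ℝ}
    (hg : IsMemoryKernel g α γ δ) : (translationOperator g V).graph = translationGraph g V := by
  refine Submodule.toLinearPMap_graph_eq _ ?_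
  rintro ⟨η, ζ⟩ ⟨f, f', h1, h2, h3, -, -⟩ h0
  simp only at h0 h1 h2 ⊢
  subst h0
  have hf : ∀ᵐ s : ℝ, s ∈ positivitySet g → f s = 0 := by
    rw [← ae_memoryMeasure_iff]
    filter_upwards [h1, Lp.coeFn_zero V 2 (memoryMeasure g)] with s a b
    rw [a, b, Pi.zero_apply]
  have hf' : ∀ᵐ s : ℝ, s ∈ positivitySet g → f' s = 0 := by
    refine hg.isOpen_positivitySet.ae_eq_zero_of_integral_contDiff_smul_eq_zero
      h3.locallyIntegrable' fun φ hφ hc hU => ?_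
    have h := h3.integral_eq φ hφ hc hU
    have hz : ∫ s, deriv φ s • f s = 0 := by
      refine integral_eq_zero_of_ae ?_
      filter_upwards [hf] with s hs
      by_cases hm : s ∈ positivitySet g
      · simp [hs hm]
      · have : deriv φ s = 0 := by
          by_contra hne
          exact hm (hU (support_deriv_subset hne))
        simp [this]
    rw [hz] at h
    exact neg_eq_zero.1 h.symm
  rw [← ae_memoryMeasure_iff] at hf'
  refine (Lp.eq_zero_iff_ae_eq_zero).2 ?_
  filter_upwards [h2, hf'] with s a b
  rw [← a, b, neg_zero, Pi.zero_apply]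

/-- The right translation by `t` of a function on `(0, ∞)`. -/
def rightTranslate (t : ℝ) (f : ℝ → V) (s : ℝ) : V := if s ≤ t then 0 else f (s - t)

end Operators

/-! ### Semigroups and generators -/

section Semigroup

variable {X : Type*} [NormedAddCommGroup X] [NormedSpace ℝ X]

/-- Strongly continuous semigroups of bounded linear operators. -/
structure IsC0Semigroup (S : ℝ≥0 → X →L[ℝ] X) : Prop where
  zero : S 0 = ContinuousLinearMap.id ℝ X
  add : ∀ t r, S (t + r) = (S t).comp (S r)
  continuous : ∀ x, Continuous fun t => S t x

/-- Strongly continuous semigroups of contractions. -/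
structure IsContractionSemigroup (S : ℝ≥0 → X →L[ℝ] X) : Prop extends IsC0Semigroup S where
  norm_le_one : ∀ t, ‖S t‖ ≤ 1

/-- The set of all pairs `(x, y)` with `(S t x - x) / t → y` as `t → 0⁺`. -/
def generatorGraph (S : ℝ≥0 → X →L[ℝ] X) : Submodule ℝ (X × X) where
  carrier := {p | Tendsto (fun t : ℝ≥0 => (t : ℝ)⁻¹ • (S t p.1 - p.1)) (𝓝[>] 0) (𝓝 p.2)}
  zero_mem' := by simp
  add_mem' {p q} hp hq := by
    refine (Tendsto.add hp hq).congr fun t => ?_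
    rw [← smul_add, Prod.fst_add, map_add]
    congr 1
    abel
  smul_mem' c p hp := by
    refine (Tendsto.const_smul hp c).congr fun t => ?_
    rw [smul_comm c, Prod.smul_fst, map_smul, smul_sub]

/-- The infinitesimal generator: its domain is the set of all `x` for which the limit of
`(S t x - x) / t` as `t → 0⁺` exists, and its value at `x` is this limit. -/
def infinitesimalGenerator (S : ℝ≥0 → X →L[ℝ] X) : X →ₗ.[ℝ] X :=
  (generatorGraph S).toLinearPMap

theorem graph_infinitesimalGenerator (S : ℝ≥0 → X →L[ℝ] X) :
    (infinitesimalGenerator S).graph = generatorGraph S := by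
  refine Submodule.toLinearPMap_graph_eq _ ?_
  rintro ⟨x, y⟩ h h0
  simp only at h0
  subst h0
  have h' : Tendsto (fun t : ℝ≥0 => (t : ℝ)⁻¹ • (S t (0 : X) - 0)) (𝓝[>] 0) (𝓝 y) := h
  simp only [map_zero, sub_zero, smul_zero] at h'
  exact tendsto_nhds_unique h' tendsto_const_nhds

end Semigroup

end

/-! Write `w = -g'`. The differential inequality says that `exp(-(α-δ)s) g'(s)` is nondecreasing, so
`w(s) ≤ exp((α-δ)(s-r)) w(r)` for `0 < r ≤ s` (`IsMemoryKernel.neg_deriv_le`). Everything about the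
weight follows from this. Shifting right by `t` costs at most a factor `exp((α-δ)t)` in the measure,
hence `exp((α-δ)t/2)` in the norm, which makes `R(t)` well defined and bounded. The set where `w >
0` is an initial interval, and `w` is bounded below on `(0, b)` for each `b` in it, so `M` embeds
continuously in `L¹(0, b)`. Strong continuity is checked on bounded continuous functions and
extended by density, the rescaled operators being contractions.

For the generator, both graphs are compared with the relation `η(s) = -∫₀ˢ ζ`. If `ζ` is the limit
of the difference quotients of `R(t)η`, moving the translation onto a test function yields `∫ φ' η =
∫ φ ζ` on `(0, b)`, even when `φ(0) ≠ 0`. Thus the extension of `η` by zero to negative `s` has weak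
derivative `-ζ` across the origin, and the du Bois-Reymond lemma gives the relation with constant
zero. For a pair in the graph of `T` the same lemma applies on `(0, b)`, the constant vanishing
because `η(0) = 0`.

Conversely, the relation turns the difference quotient into the mean of `R(r)ζ` over `0 < r ≤ t`.
Jensen's inequality and Tonelli's theorem bound its distance to `ζ` by the supremum of `‖R(r)ζ - ζ‖`
over `r ≤ t`, which tends to zero (`eLpNorm_slope_sub_le`). -/

/-! ### Growth of the weight and comparison of measures -/

section Kernel

variable {g : ℝ → ℝ} {α γ δ : ℝ}

/-- The weight `-g'` grows at most exponentially. -/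
theorem IsMemoryKernel.neg_deriv_le (hg : IsMemoryKernel g α γ δ) {r s : ℝ} (hr : 0 < r)
    (hrs : r ≤ s) : -deriv g s ≤ Real.exp ((α - δ) * (s - r)) * -deriv g r := by
  set e : ℝ → ℝ := fun x => Real.exp (-((α - δ) * x)) with he
  have he_deriv : ∀ x, HasDerivAt e (-(α - δ) * e x) x := by
    intro x
    have h : HasDerivAt (fun x : ℝ => -((α - δ) * x)) (-(α - δ)) x := by
      simpa using ((hasDerivAt_id x).const_mul (α - δ)).fun_neg
    simpa [he, mul_comm] using h.exp
  have hAC := hg.locallyAC_deriv r s hr hrs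
  have hAC_e : AbsolutelyContinuousOnInterval e r s := by
    refine ContDiffOn.absolutelyContinuousOnInterval ?_
    exact ContDiff.contDiffOn (by fun_prop)
  have hmul := hAC_e.fun_mul hAC
  have hint := hmul.integral_deriv_eq_sub
  -- With the integrating factor, `(e g')' = e (g'' - (α-δ) g') ≥ 0` almost everywhere; absolute
  -- continuity turns this into monotonicity of `e g'`.
  have hnonneg : 0 ≤ ∫ x in r..s, deriv (fun x => e x * deriv g x) x := by
    refine intervalIntegral.integral_nonneg_of_ae_restrict hrs ?_
    refine (ae_restrict_iff' measurableSet_Icc).2 ?_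
    filter_upwards [hAC.ae_differentiableAt, hg.deriv_deriv] with x hx hx' hxmem
    have hd : DifferentiableAt ℝ (deriv g) x := hx (by rwa [uIcc_of_le hrs])
    have h2 := (he_deriv x).mul hd.hasDerivAt
    have h3 := hx' (hr.trans_le hxmem.1)
    have h4 : deriv (fun x => e x * deriv g x) x
        = -(α - δ) * e x * deriv g x + e x * deriv (deriv g) x := h2.deriv
    have h5 : 0 < e x := Real.exp_pos _
    rw [h4, Pi.zero_apply]
    nlinarith
  rw [hint] at hnonneg
  have h6 : Real.exp ((α - δ) * (s - r)) = Real.exp ((α - δ) * s) * e r := by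
    rw [he, ← Real.exp_add]; congr 1; ring
  have h7 : Real.exp ((α - δ) * s) * e s = 1 := by
    rw [he, ← Real.exp_add]; simp
  rw [h6]
  have h8 : 0 < Real.exp ((α - δ) * s) := Real.exp_pos _
  have h9 : 0 ≤ Real.exp ((α - δ) * s) * (e s * deriv g s - e r * deriv g r) :=
    mul_nonneg h8.le hnonneg
  have h10 : Real.exp ((α - δ) * s) * (e s * deriv g s - e r * deriv g r)
      = deriv g s - Real.exp ((α - δ) * s) * e r * deriv g r := by
    rw [mul_sub, ← mul_assoc, h7]; ring
  linarith

/-- By the exponential bound, a zero of the weight forces it to vanish at all later points. Hence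
the positivity set is an interval starting at the origin. -/
theorem IsMemoryKernel.mem_positivitySet_of_le (hg : IsMemoryKernel g α γ δ) {r s : ℝ}
    (hr : 0 < r) (hrs : r ≤ s) (hs : s ∈ positivitySet g) : r ∈ positivitySet g := by
  refine ⟨hr, ?_⟩
  have h := hg.neg_deriv_le hr hrs
  have h1 := hs.2
  have h2 : 0 < Real.exp ((α - δ) * (s - r)) := Real.exp_pos _
  by_contra hn
  nlinarith [mul_nonneg h2.le (not_lt.1 hn)]

theorem IsMemoryKernel.isFiniteMeasure (hg : IsMemoryKernel g α γ δ) :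
    IsFiniteMeasure (memoryMeasure g) :=
  isFiniteMeasure_withDensity_ofReal hg.integrable_deriv.neg.2

/-- Written as an integral over the whole line, so that translation invariance applies and measures
can be compared pointwise through their densities. -/
theorem memoryMeasure_apply (g : ℝ → ℝ) {E : Set ℝ} (hE : MeasurableSet E) :
    memoryMeasure g E
      = ∫⁻ s, (E ∩ Ioi 0).indicator (fun s => ENNReal.ofReal (-deriv g s)) s := by
  rw [memoryMeasure, withDensity_apply _ hE, Measure.restrict_restrict hE,
    lintegral_indicator (hE.inter measurableSet_Ioi)]

/-- Translating the memory measure to the left costs an exponential factor. -/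
theorem IsMemoryKernel.map_restrict_le (hg : IsMemoryKernel g α γ δ) {t : ℝ} (ht : 0 ≤ t) :
    ((memoryMeasure g).restrict (Ioi t)).map (fun s => s - t)
      ≤ ENNReal.ofReal (Real.exp ((α - δ) * t)) • memoryMeasure g := by
  have hm : Measurable fun s : ℝ => s - t := measurable_id.sub_const t
  refine Measure.le_iff.2 fun E hE => ?_
  rw [Measure.map_apply hm hE, Measure.restrict_apply (hm hE), Measure.smul_apply,
    memoryMeasure_apply g ((hm hE).inter measurableSet_Ioi), memoryMeasure_apply g hE, smul_eq_mul,
    ← lintegral_const_mul' _ _ ENNReal.ofReal_ne_top, ← lintegral_sub_right_eq_self (fun s => _ * (E ∩ Ioi 0).indicator _ s) t]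
  refine lintegral_mono fun s => ?_
  by_cases hs : s ∈ (fun s : ℝ => s - t) ⁻¹' E ∩ Ioi t ∩ Ioi 0
  · have hst : 0 < s - t := sub_pos.2 hs.1.2
    have hs' : s - t ∈ E ∩ Ioi 0 := ⟨hs.1.1, hst⟩
    rw [indicator_of_mem hs, indicator_of_mem hs', ← ENNReal.ofReal_mul (Real.exp_pos _).le]
    refine ENNReal.ofReal_le_ofReal ?_
    simpa using hg.neg_deriv_le hst (by linarith : s - t ≤ s)
  · rw [indicator_of_notMem hs]
    exact zero_le

/-- Near the origin the memory measure controls the Lebesgue measure. -/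
theorem IsMemoryKernel.exists_restrict_le (hg : IsMemoryKernel g α γ δ) {b : ℝ}
    (hb : b ∈ positivitySet g) :
    ∃ K : ℝ≥0, volume.restrict (Ioo 0 b) ≤ (K : ℝ≥0∞) • memoryMeasure g := by
  have hw : 0 < -deriv g b := neg_pos.2 hb.2
  -- For `0 < s < b` the growth bound from `s` to `b` gives `-g'(s) ≥ exp(-(α-δ)b) (-g'(b))`, that
  -- is `1 ≤ c (-g'(s))`.
  set c : ℝ := Real.exp ((α - δ) * b) / -deriv g b with hc
  have hαδ : 0 < α - δ := sub_pos.2 hg.delta_lt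
  refine ⟨c.toNNReal, Measure.le_iff.2 fun E hE => ?_⟩
  rw [Measure.restrict_apply hE, Measure.smul_apply, memoryMeasure_apply g hE, smul_eq_mul,
    ← lintegral_const_mul' _ _ ENNReal.coe_ne_top,
    ← lintegral_indicator_one (hE.inter measurableSet_Ioo)]
  refine lintegral_mono fun s => ?_
  by_cases hs : s ∈ E ∩ Ioo 0 b
  · rw [indicator_of_mem hs, indicator_of_mem (show s ∈ E ∩ Ioi 0 from ⟨hs.1, hs.2.1⟩),
      ← ENNReal.ofReal, ← ENNReal.ofReal_mul (by positivity), Pi.one_apply, ← ENNReal.ofReal_one]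
    refine ENNReal.ofReal_le_ofReal ?_
    rw [hc, div_mul_eq_mul_div, one_le_div hw]
    have h1 := hg.neg_deriv_le hs.2.1 hs.2.2.le
    have h2 : Real.exp ((α - δ) * (b - s)) ≤ Real.exp ((α - δ) * b) :=
      Real.exp_le_exp.2 (by nlinarith [hs.2.1])
    have h3 : 0 ≤ -deriv g s := neg_nonneg.2 (hg.deriv_nonpos s hs.2.1)
    exact h1.trans (mul_le_mul_of_nonneg_right h2 h3)
  · rw [indicator_of_notMem hs]
    exact zero_le

end Kernel

/-! ### The translation operators and their algebra -/

section Translation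

variable {V : Type*} [NormedAddCommGroup V]

theorem rightTranslate_eq_indicator (t : ℝ) (f : ℝ → V) :
    rightTranslate t f = (Ioi t).indicator (f ∘ fun s => s - t) := by
  ext s
  by_cases h : s ≤ t
  · simp [rightTranslate, h]
  · simp [rightTranslate, h, not_le.1 h]

theorem rightTranslate_eq_indicator_sub {t : ℝ} (f : ℝ → V) (s : ℝ) :
    rightTranslate t f s = (Ioi 0).indicator f (s - t) := by
  by_cases h : s ≤ t
  · simp [rightTranslate, h]
  · simp [rightTranslate, h, not_le.1 h]

theorem rightTranslate_rightTranslate {t r : ℝ} (hr : 0 ≤ r) (f : ℝ → V) :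
    rightTranslate t (rightTranslate r f) = rightTranslate (t + r) f := by
  ext s
  by_cases h1 : s ≤ t
  · simp [rightTranslate, h1, (by linarith : s ≤ t + r)]
  · by_cases h2 : s ≤ t + r
    · simp [rightTranslate, h1, h2, (by linarith : s - t ≤ r)]
    · simp [rightTranslate, h1, h2, (by linarith : ¬ s - t ≤ r), sub_sub]

variable {g : ℝ → ℝ} {α γ δ : ℝ}

/-- Makes `R(t)` well defined on classes: the translated measure is dominated by a multiple of the
original one, so null sets shift to null sets. -/
theorem IsMemoryKernel.rightTranslate_congr (hg : IsMemoryKernel g α γ δ) {t : ℝ} (ht : 0 ≤ t)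
    {f₁ f₂ : ℝ → V} (h : f₁ =ᵐ[memoryMeasure g] f₂) :
    rightTranslate t f₁ =ᵐ[memoryMeasure g] rightTranslate t f₂ := by
  have hm : Measurable fun s : ℝ => s - t := measurable_id.sub_const t
  have h1 : f₁ =ᵐ[((memoryMeasure g).restrict (Ioi t)).map (fun s => s - t)] f₂ :=
    (Measure.absolutelyContinuous_of_le_smul (hg.map_restrict_le ht)).ae_le h
  have h2 := ae_of_ae_map hm.aemeasurable h1
  rw [ae_restrict_iff' measurableSet_Ioi] at h2
  filter_upwards [h2] with s hs
  by_cases hst : s ≤ t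
  · simp [rightTranslate, hst]
  · simpa [rightTranslate, hst] using hs (not_le.1 hst)

theorem IsMemoryKernel.aestronglyMeasurable_rightTranslate (hg : IsMemoryKernel g α γ δ) {t : ℝ}
    (ht : 0 ≤ t) {f : ℝ → V} (hf : AEStronglyMeasurable f (memoryMeasure g)) :
    AEStronglyMeasurable (rightTranslate t f) (memoryMeasure g) := by
  have hm : Measurable fun s : ℝ => s - t := measurable_id.sub_const t
  refine AEStronglyMeasurable.congr ?_ (hg.rightTranslate_congr ht hf.ae_eq_mk).symm
  rw [rightTranslate_eq_indicator]
  exact ((hf.stronglyMeasurable_mk.comp_measurable hm).indicator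
    measurableSet_Ioi).aestronglyMeasurable

theorem IsMemoryKernel.eLpNorm_rightTranslate_le (hg : IsMemoryKernel g α γ δ) {t : ℝ}
    (ht : 0 ≤ t) {f : ℝ → V} (hf : AEStronglyMeasurable f (memoryMeasure g)) :
    eLpNorm (rightTranslate t f) 2 (memoryMeasure g)
      ≤ ENNReal.ofReal (Real.exp ((α - δ) * t / 2)) * eLpNorm f 2 (memoryMeasure g) := by
  have hm : Measurable fun s : ℝ => s - t := measurable_id.sub_const t
  have hle := hg.map_restrict_le ht
  have hf' : AEStronglyMeasurable f
      (((memoryMeasure g).restrict (Ioi t)).map (fun s => s - t)) :=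
    hf.mono_ac (Measure.absolutelyContinuous_of_le_smul hle)
  rw [rightTranslate_eq_indicator, eLpNorm_indicator_eq_eLpNorm_restrict measurableSet_Ioi,
    ← eLpNorm_map_measure hf' hm.aemeasurable]
  -- A scalar factor in the measure enters the `L²` norm through its square root; this halves the
  -- exponent.
  refine (eLpNorm_mono_measure f hle).trans ((eLpNorm_smul_measure_le _ _ _ _).trans_eq ?_)
  rw [smul_eq_mul, ENNReal.ofReal_rpow_of_pos (Real.exp_pos _), ← Real.exp_mul]
  congr 4
  simp [div_eq_mul_inv]

theorem IsMemoryKernel.memLp_rightTranslate (hg : IsMemoryKernel g α γ δ) {t : ℝ}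
    (ht : 0 ≤ t) {f : ℝ → V} (hf : MemLp f 2 (memoryMeasure g)) :
    MemLp (rightTranslate t f) 2 (memoryMeasure g) :=
  ⟨hg.aestronglyMeasurable_rightTranslate ht hf.1,
    (hg.eLpNorm_rightTranslate_le ht hf.1).trans_lt
      (ENNReal.mul_lt_top ENNReal.ofReal_lt_top hf.2)⟩

/-- The right translation `R(t)` as a bounded operator on the memory space. -/
noncomputable def translationSemigroup (V : Type*) [NormedAddCommGroup V] [InnerProductSpace ℝ V]
    (hg : IsMemoryKernel g α γ δ) (t : ℝ≥0) : MemorySpace g V →L[ℝ] MemorySpace g V :=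
  LinearMap.mkContinuous
    { toFun := fun η => (hg.memLp_rightTranslate t.coe_nonneg (Lp.memLp η)).toLp _
      map_add' := fun η ξ => by
        rw [← MemLp.toLp_add]
        refine (MemLp.toLp_eq_toLp_iff _ _).2
          ((hg.rightTranslate_congr t.coe_nonneg (Lp.coeFn_add η ξ)).trans (Eventually.of_forall fun s => ?_))
        by_cases h : s ≤ (t : ℝ) <;> simp [rightTranslate, h]
      map_smul' := fun c η => by
        rw [RingHom.id_apply, ← MemLp.toLp_const_smul]
        refine (MemLp.toLp_eq_toLp_iff _ _).2
          ((hg.rightTranslate_congr t.coe_nonneg (Lp.coeFn_smul c η)).trans (Eventually.of_forall fun s => ?_))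
        by_cases h : s ≤ (t : ℝ) <;> simp [rightTranslate, h] }
    (Real.exp ((α - δ) * t / 2)) fun η => by
      have h := hg.eLpNorm_rightTranslate_le t.coe_nonneg (Lp.aestronglyMeasurable η)
      have h' := ENNReal.toReal_mono
        (ENNReal.mul_ne_top ENNReal.ofReal_ne_top (Lp.eLpNorm_ne_top η)) h
      rw [ENNReal.toReal_mul, ENNReal.toReal_ofReal (Real.exp_pos _).le] at h'
      rw [LinearMap.coe_mk, AddHom.coe_mk, Lp.norm_toLp, Lp.norm_def]
      exact h'

variable [InnerProductSpace ℝ V]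

theorem coeFn_translationSemigroup (hg : IsMemoryKernel g α γ δ) (t : ℝ≥0)
    (η : MemorySpace g V) :
    translationSemigroup V hg t η =ᵐ[memoryMeasure g] rightTranslate (t : ℝ) η :=
  (hg.memLp_rightTranslate t.coe_nonneg (Lp.memLp η)).coeFn_toLp

theorem norm_translationSemigroup_le (hg : IsMemoryKernel g α γ δ) (t : ℝ≥0) :
    ‖translationSemigroup V hg t‖ ≤ Real.exp ((α - δ) * t / 2) :=
  LinearMap.mkContinuous_norm_le _ (Real.exp_pos _).le _

theorem translationSemigroup_zero (hg : IsMemoryKernel g α γ δ) :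
    translationSemigroup V hg 0 = ContinuousLinearMap.id ℝ (MemorySpace g V) := by
  ext1 η
  refine Lp.ext ((coeFn_translationSemigroup hg 0 η).trans ?_)
  have h : ∀ᵐ s ∂memoryMeasure g, 0 < s :=
    (ae_memoryMeasure_iff g _).2 (Eventually.of_forall fun s hs => hs.1)
  filter_upwards [h] with s hs
  simp [rightTranslate, hs]

theorem translationSemigroup_add (hg : IsMemoryKernel g α γ δ) (t r : ℝ≥0) :
    translationSemigroup V hg (t + r)
      = (translationSemigroup V hg t).comp (translationSemigroup V hg r) := by
  ext1 η
  refine Lp.ext ((coeFn_translationSemigroup hg (t + r) η).trans ?_)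
  rw [ContinuousLinearMap.comp_apply]
  refine EventuallyEq.trans ?_ (coeFn_translationSemigroup hg t _).symm
  refine EventuallyEq.trans ?_
    (hg.rightTranslate_congr t.coe_nonneg (coeFn_translationSemigroup hg r η)).symm
  rw [rightTranslate_rightTranslate r.coe_nonneg, NNReal.coe_add]

end Translation

/-! ### Strong continuity and contractivity -/

theorem eLpNorm_two_sq {X E : Type*} [MeasurableSpace X] [NormedAddCommGroup E] {μ : Measure X}
    (f : X → E) : eLpNorm f 2 μ ^ 2 = ∫⁻ x, ‖f x‖ₑ ^ 2 ∂μ := by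
  have h := eLpNorm_nnreal_pow_eq_lintegral (f := f) (μ := μ) (p := 2) two_ne_zero
  simpa using h

section StrongContinuity

variable {V : Type*} [NormedAddCommGroup V] {g : ℝ → ℝ} {α γ δ : ℝ}

/-- The translate of a continuous function may jump only at the front `s = t₀`, a single point and
hence negligible. -/
theorem tendsto_rightTranslate_of_ne {f : ℝ → V} (hf : Continuous f) {t₀ s : ℝ} (h : s ≠ t₀) :
    Tendsto (fun t => rightTranslate t f s) (𝓝 t₀) (𝓝 (rightTranslate t₀ f s)) := by
  rcases lt_or_gt_of_ne h with h | h
  · refine tendsto_const_nhds.congr' ?_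
    filter_upwards [Ioi_mem_nhds h] with t ht
    have ht' : s < t := ht
    simp [rightTranslate, h.le, ht'.le]
  · have h1 : Tendsto (fun t => f (s - t)) (𝓝 t₀) (𝓝 (f (s - t₀))) :=
      (hf.comp (continuous_const.sub continuous_id)).tendsto t₀
    rw [show rightTranslate t₀ f s = f (s - t₀) by simp [rightTranslate, h]]
    refine h1.congr' ?_
    filter_upwards [Iio_mem_nhds h] with t ht
    have ht' : t < s := ht
    simp [rightTranslate, ht']

theorem norm_rightTranslate_le {f : ℝ → V} {C : ℝ} (hC : ∀ s, ‖f s‖ ≤ C) (t s : ℝ) :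
    ‖rightTranslate t f s‖ ≤ C := by
  unfold rightTranslate
  split_ifs
  · simpa using (norm_nonneg _).trans (hC s)
  · exact hC _

variable [InnerProductSpace ℝ V]

/-- Dominated convergence for the squared norm of the difference: the memory measure is finite, so
the constant `(C + C)²` is an integrable majorant. -/
theorem continuous_translationSemigroup_of_bounded (hg : IsMemoryKernel g α γ δ) {f : ℝ → V}
    (hf : Continuous f) {C : ℝ} (hC : ∀ s, ‖f s‖ ≤ C) (hfm : MemLp f 2 (memoryMeasure g)) :
    Continuous fun t : ℝ≥0 => translationSemigroup V hg t (hfm.toLp f) := by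
  have := hg.isFiniteMeasure
  have hR : ∀ t : ℝ≥0, translationSemigroup V hg t (hfm.toLp f)
      =ᵐ[memoryMeasure g] rightTranslate (t : ℝ) f := fun t =>
    (coeFn_translationSemigroup hg t _).trans (hg.rightTranslate_congr t.coe_nonneg hfm.coeFn_toLp)
  refine continuous_iff_continuousAt.2 fun t₀ => ?_
  rw [ContinuousAt, Lp.tendsto_Lp_iff_tendsto_eLpNorm']
  have hsq : Tendsto (fun t : ℝ≥0 => ∫⁻ s,
      ‖rightTranslate (t : ℝ) f s - rightTranslate (t₀ : ℝ) f s‖ₑ ^ 2 ∂memoryMeasure g)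
      (𝓝 t₀) (𝓝 (∫⁻ _, 0 ∂memoryMeasure g)) := by
    refine tendsto_lintegral_filter_of_dominated_convergence'
      (fun _ => ENNReal.ofReal (C + C) ^ 2) ?_ ?_ ?_ ?_
    · exact Eventually.of_forall fun t =>
        ((hg.aestronglyMeasurable_rightTranslate t.coe_nonneg hfm.1).sub
          (hg.aestronglyMeasurable_rightTranslate t₀.coe_nonneg hfm.1)).enorm.pow_const 2
    · refine Eventually.of_forall fun t => Eventually.of_forall fun s => ?_
      gcongr
      rw [← ofReal_norm]
      exact ENNReal.ofReal_le_ofReal ((norm_sub_le _ _).trans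
        (add_le_add (norm_rightTranslate_le hC _ _) (norm_rightTranslate_le hC _ _)))
    · rw [lintegral_const]
      exact ENNReal.mul_ne_top (by simp) (measure_ne_top _ _)
    · have hne : ∀ᵐ s : ℝ, s ≠ (t₀ : ℝ) := by simp [ae_iff]
      refine (ae_memoryMeasure_iff g _).2 ?_
      filter_upwards [hne] with s hs _
      have h1 : Tendsto (fun t : ℝ≥0 => rightTranslate (t : ℝ) f s) (𝓝 t₀)
          (𝓝 (rightTranslate (t₀ : ℝ) f s)) :=
        (tendsto_rightTranslate_of_ne hf hs).comp (NNReal.continuous_coe.tendsto t₀)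
      have h2 := ENNReal.Tendsto.pow (n := 2) (h1.sub_const (rightTranslate (t₀ : ℝ) f s)).enorm
      simpa using h2
  rw [lintegral_zero] at hsq
  have hroot := (ENNReal.continuous_rpow_const (y := (1 / 2 : ℝ))).tendsto 0 |>.comp hsq
  rw [ENNReal.zero_rpow_of_pos (by norm_num)] at hroot
  refine hroot.congr fun t => ?_
  have hcongr : eLpNorm (fun s => rightTranslate (t : ℝ) f s - rightTranslate (t₀ : ℝ) f s) 2
      (memoryMeasure g) = eLpNorm (⇑(translationSemigroup V hg t (hfm.toLp f))
        - ⇑(translationSemigroup V hg t₀ (hfm.toLp f))) 2 (memoryMeasure g) :=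
    eLpNorm_congr_ae ((hR t).sub (hR t₀)).symm
  rw [Function.comp_apply, ← eLpNorm_two_sq, hcongr, ← ENNReal.rpow_natCast, ← ENNReal.rpow_mul]
  simp

theorem norm_exp_smul_translationSemigroup_le (hg : IsMemoryKernel g α γ δ) (t : ℝ≥0) :
    ‖Real.exp (-((α - δ) * (t : ℝ) / 2)) • translationSemigroup V hg t‖ ≤ 1 := by
  refine ContinuousLinearMap.opNorm_le_bound _ zero_le_one fun η => ?_
  rw [smul_apply, norm_smul, Real.norm_of_nonneg (Real.exp_pos _).le]
  refine (mul_le_mul_of_nonneg_left (ContinuousLinearMap.le_of_opNorm_le _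
    (norm_translationSemigroup_le hg t) η) (Real.exp_pos _).le).trans_eq ?_
  rw [← mul_assoc, ← Real.exp_add, neg_add_cancel, Real.exp_zero]

/-- Bounded continuous functions are dense in `M`. Since the rescaled operators are contractions,
approximating `η` approximates its orbit uniformly over all `t ≥ 0`, and uniform limits preserve
continuity. -/
theorem continuous_exp_smul_translationSemigroup (hg : IsMemoryKernel g α γ δ)
    (η : MemorySpace g V) : Continuous fun t : ℝ≥0 =>
      (Real.exp (-((α - δ) * (t : ℝ) / 2)) • translationSemigroup V hg t) η := by
  have := hg.isFiniteMeasure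
  refine continuous_of_uniform_approx_of_continuous fun u hu => ?_
  obtain ⟨ε, hε, hεu⟩ := Metric.mem_uniformity_dist.1 hu
  obtain ⟨f, hfε, hfm⟩ := (Lp.memLp η).exists_boundedContinuous_eLpNorm_sub_le
    ENNReal.ofNat_ne_top (ε := ENNReal.ofReal (ε / 2)) (by simpa using hε)
  have hdist : ‖η - hfm.toLp f‖ < ε := by
    rw [Lp.norm_def]
    refine (ENNReal.toReal_mono ENNReal.ofReal_ne_top
      ((eLpNorm_congr_ae ?_).trans_le hfε)).trans_lt ?_
    · exact (Lp.coeFn_sub _ _).trans (EventuallyEq.rfl.sub hfm.coeFn_toLp)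
    · rw [ENNReal.toReal_ofReal (by positivity)]
      linarith
  refine ⟨fun t : ℝ≥0 => (Real.exp (-((α - δ) * (t : ℝ) / 2)) • translationSemigroup V hg t)
    (hfm.toLp f), ?_, fun t => hεu ?_⟩
  · have h1 := continuous_translationSemigroup_of_bounded hg f.continuous f.norm_coe_le_norm hfm
    have h2 : Continuous fun t : ℝ≥0 => Real.exp (-((α - δ) * (t : ℝ) / 2)) := by fun_prop
    exact h2.smul h1
  · rw [dist_eq_norm, ← map_sub]
    refine (ContinuousLinearMap.le_opNorm _ _).trans_lt ?_
    exact (mul_le_of_le_one_left (norm_nonneg _)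
      (norm_exp_smul_translationSemigroup_le hg t)).trans_lt hdist

theorem isC0Semigroup_translationSemigroup (hg : IsMemoryKernel g α γ δ) :
    IsC0Semigroup (translationSemigroup V hg) where
  zero := translationSemigroup_zero hg
  add := translationSemigroup_add hg
  continuous η := by
    have h2 : Continuous fun t : ℝ≥0 => Real.exp ((α - δ) * (t : ℝ) / 2) := by fun_prop
    refine (h2.smul (continuous_exp_smul_translationSemigroup hg η)).congr fun t => ?_
    rw [Pi.smul_apply', smul_apply, smul_smul, ← Real.exp_add, add_neg_cancel, Real.exp_zero,
      one_smul]

theorem isContractionSemigroup_translationSemigroup (hg : IsMemoryKernel g α γ δ) :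
    IsContractionSemigroup fun t : ℝ≥0 =>
      Real.exp (-((α - δ) * (t : ℝ) / 2)) • translationSemigroup V hg t where
  zero := by simp [translationSemigroup_zero hg]
  add t r := by
    ext1 η
    simp only [translationSemigroup_add hg t r, smul_apply,
      ContinuousLinearMap.comp_apply, map_smul, smul_smul, ← Real.exp_add]
    congr 2
    push_cast
    ring
  continuous := continuous_exp_smul_translationSemigroup hg
  norm_le_one := norm_exp_smul_translationSemigroup_le hg

end StrongContinuity

/-! ### Weak derivatives on an interval -/

section WeakDerivative

variable {V : Type*} [NormedAddCommGroup V] [InnerProductSpace ℝ V]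

/-- Integration by parts of a test function against the primitive of an integrable function. -/
theorem integral_deriv_smul_setIntegral_Iic [CompleteSpace V] {w : ℝ → V} (hw : Integrable w)
    {φ : ℝ → ℝ} (hφ : ContDiff ℝ ∞ φ) (hc : HasCompactSupport φ) :
    ∫ s, deriv φ s • ∫ r in Iic s, w r = -∫ r, φ r • w r := by
  have hφ' : Integrable (deriv φ) :=
    (hφ.continuous_deriv (by simp)).integrable_of_hasCompactSupport hc.deriv
  -- Fubini on the half-plane `r ≤ s`: integrating `φ'` over `[r, ∞)` first leaves `-φ(r)`.
  set D : Set (ℝ × ℝ) := {p | p.2 ≤ p.1} with hD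
  have hDm : MeasurableSet D := measurableSet_le measurable_snd measurable_fst
  have hint : Integrable (D.indicator fun p : ℝ × ℝ => deriv φ p.1 • w p.2)
      (volume.prod volume) := (hφ'.smul_prod hw).indicator hDm
  have h1 : ∀ s, deriv φ s • ∫ r in Iic s, w r
      = ∫ r, D.indicator (fun p : ℝ × ℝ => deriv φ p.1 • w p.2) (s, r) := by
    intro s
    rw [← integral_smul, ← integral_indicator measurableSet_Iic]
    refine integral_congr_ae (Eventually.of_forall fun r => ?_)
    by_cases hr : r ≤ s <;> simp [hD, indicator, hr]
  have h2 : ∀ r, ∫ s, D.indicator (fun p : ℝ × ℝ => deriv φ p.1 • w p.2) (s, r)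
      = -(φ r • w r) := by
    intro r
    have h3 : ∀ s, D.indicator (fun p : ℝ × ℝ => deriv φ p.1 • w p.2) (s, r)
        = (Ici r).indicator (deriv φ) s • w r := by
      intro s
      by_cases hr : r ≤ s <;> simp [hD, indicator, hr]
    simp_rw [h3]
    rw [integral_smul_const, integral_indicator measurableSet_Ici, integral_Ici_eq_integral_Ioi,
      hc.integral_Ioi_deriv_eq (hφ.of_le (by simp)), neg_smul]
  simp_rw [h1]
  rw [integral_integral_swap (f := fun s r =>
    D.indicator (fun p : ℝ × ℝ => deriv φ p.1 • w p.2) (s, r)) hint]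
  simp_rw [h2]
  rw [integral_neg]

theorem exists_Icc_of_isCompact_subset_Ioo {a b : ℝ} (hab : a < b) {K : Set ℝ}
    (hK : IsCompact K) (hKab : K ⊆ Ioo a b) : ∃ c d, a < c ∧ d < b ∧ K ⊆ Icc c d := by
  rcases K.eq_empty_or_nonempty with rfl | hne
  -- For the empty set the endpoints are swapped, which makes both strict inequalities equal to
  -- `hab`.
  · exact ⟨b, a, hab, hab, empty_subset _⟩
  · exact ⟨sInf K, sSup K, (hKab (hK.sInf_mem hne)).1, (hKab (hK.sSup_mem hne)).2,
      subset_Icc_csInf_csSup hK.bddBelow hK.bddAbove⟩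

/-- A test function on an interval with vanishing integral is the derivative of a test function. -/
theorem exists_deriv_eq_of_integral_eq_zero {a b : ℝ} (hab : a < b) {φ : ℝ → ℝ}
    (hφ : ContDiff ℝ ∞ φ) (hc : HasCompactSupport φ) (hs : tsupport φ ⊆ Ioo a b)
    (h0 : ∫ s, φ s = 0) :
    ∃ χ : ℝ → ℝ, ContDiff ℝ ∞ χ ∧ HasCompactSupport χ ∧ tsupport χ ⊆ Ioo a b ∧ deriv χ = φ := by
  obtain ⟨c, d, hac, hdb, hK⟩ := exists_Icc_of_isCompact_subset_Ioo hab hc hs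
  have hzero : ∀ x, x ∉ Icc c d → φ x = 0 := fun x hx =>
    image_eq_zero_of_notMem_tsupport fun h => hx (hK h)
  have hφi : Integrable φ := hφ.continuous.integrable_of_hasCompactSupport hc
  set χ : ℝ → ℝ := fun x => ∫ r in a..x, φ r with hχ
  have hderiv : ∀ x, HasDerivAt χ (φ x) x := fun x =>
    intervalIntegral.integral_hasDerivAt_right hφi.intervalIntegrable
      hφ.continuous.stronglyMeasurable.stronglyMeasurableAtFilter hφ.continuous.continuousAt
  have hsupp : tsupport χ ⊆ Icc c d := by
    refine closure_minimal (fun x hx => ?_) isClosed_Icc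
    by_contra hxn
    refine hx ?_
    rcases lt_or_ge x c with h | h
    · refine intervalIntegral.integral_zero_ae (Eventually.of_forall fun r hr => hzero r fun h' => ?_)
      have := hr.2
      rw [le_max_iff] at this
      rcases this with h2 | h2 <;> linarith [h'.1]
    · have hdx : d < x := by
        by_contra h'
        exact hxn ⟨h, not_lt.1 h'⟩
      -- To the right of `d` the primitive already equals the full integral of `φ`, which is zero.
      rw [← h0]
      refine intervalIntegral.integral_eq_integral_of_support_subset fun r hr => ?_
      have hr' : r ∈ Icc c d := by
        by_contra h'
        exact hr (hzero r h')
      exact ⟨by linarith [hr'.1], by linarith [hr'.2]⟩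
  have hdχ : deriv χ = φ := funext fun x => (hderiv x).deriv
  refine ⟨χ, ?_, HasCompactSupport.of_support_subset_isCompact isCompact_Icc
    ((subset_tsupport χ).trans hsupp), hsupp.trans fun x hx => ⟨hac.trans_le hx.1,
      hx.2.trans_lt hdb⟩, hdχ⟩
  rw [contDiff_infty_iff_deriv, hdχ]
  exact ⟨fun x => (hderiv x).differentiableAt, hφ⟩

/-- The du Bois-Reymond lemma. -/
theorem exists_ae_eq_const_of_integral_deriv_smul_eq_zero [CompleteSpace V] {a b : ℝ} {u : ℝ → V}
    (hu : LocallyIntegrableOn u (Ioo a b))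
    (h : ∀ φ : ℝ → ℝ, ContDiff ℝ ∞ φ → HasCompactSupport φ → tsupport φ ⊆ Ioo a b →
      ∫ s, deriv φ s • u s = 0) :
    ∃ c : V, ∀ᵐ s : ℝ, s ∈ Ioo a b → u s = c := by
  rcases le_or_gt b a with hba | hab
  · exact ⟨0, Eventually.of_forall fun s hs => absurd (hs.1.trans hs.2) (not_lt.2 hba)⟩
  let B : ContDiffBump ((a + b) / 2) := ⟨(b - a) / 8, (b - a) / 4, by linarith, by linarith⟩
  set ψ : ℝ → ℝ := B.normed volume with hψ
  have hψ1 : ContDiff ℝ ∞ ψ := B.contDiff_normed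
  have hψ2 : HasCompactSupport ψ := B.hasCompactSupport_normed
  have hψ3 : tsupport ψ ⊆ Ioo a b := by
    rw [hψ, B.tsupport_normed_eq, Real.closedBall_eq_Icc]
    intro x hx
    have h1 : (a + b) / 2 - (b - a) / 4 ≤ x := hx.1
    have h2 : x ≤ (a + b) / 2 + (b - a) / 4 := hx.2
    constructor <;> linarith
  have hψ4 : ∫ s, ψ s = 1 := B.integral_normed
  -- As `ψ` has integral one, the constant can only be the mean of `u` against `ψ`.
  set c : V := ∫ s, ψ s • u s with hc_def
  refine ⟨c, ?_⟩
  have hsub : LocallyIntegrableOn (fun s => u s - c) (Ioo a b) :=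
    hu.sub (locallyIntegrableOn_const c)
  have hae := isOpen_Ioo.ae_eq_zero_of_integral_contDiff_smul_eq_zero hsub
    fun φ hφ hc hs => ?_
  · filter_upwards [hae] with s hs hmem using sub_eq_zero.1 (hs hmem)
  have hφi : Integrable φ := hφ.continuous.integrable_of_hasCompactSupport hc
  have hψi : Integrable ψ := hψ1.continuous.integrable_of_hasCompactSupport hψ2
  set m : ℝ := ∫ s, φ s with hm
  have hts : tsupport (fun s => φ s - m * ψ s) ⊆ tsupport φ ∪ tsupport ψ := by
    refine closure_minimal (fun s hs => ?_) ((isClosed_tsupport φ).union (isClosed_tsupport ψ))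
    by_contra hn
    rw [mem_union, not_or] at hn
    exact hs (by simp [image_eq_zero_of_notMem_tsupport hn.1,
      image_eq_zero_of_notMem_tsupport hn.2])
  -- Subtracting `m ψ` removes the integral of `φ`, so the hypothesis on derivatives of test
  -- functions applies to an arbitrary `φ`.
  obtain ⟨χ, hχ1, hχ2, hχ3, hχ4⟩ := exists_deriv_eq_of_integral_eq_zero hab
    (φ := fun s => φ s - m * ψ s) (hφ.sub (contDiff_const.mul hψ1))
    ((hc.union hψ2).of_isClosed_subset (isClosed_tsupport _) hts)
    (hts.trans (union_subset hs hψ3))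
    (by rw [integral_sub hφi (hψi.const_mul m), integral_const_mul, hψ4, mul_one, sub_self])
  have hz := h χ hχ1 hχ2 hχ3
  have hφu := integrable_smul_of_tsupport_subset hu hφ.continuous hc hs
  have hψu := integrable_smul_of_tsupport_subset hu hψ1.continuous hψ2 hψ3
  rw [hχ4] at hz
  simp_rw [sub_smul, mul_smul] at hz
  rw [integral_sub hφu (hψu.fun_smul m), integral_smul, ← hc_def] at hz
  simp_rw [smul_sub]
  rw [integral_sub hφu (hφi.smul_const c), integral_smul_const, hz]

/-- A function with integrable weak derivative on an interval is a primitive of it. -/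
theorem exists_ae_eq_const_add_setIntegral [CompleteSpace V] {a b : ℝ} {u v : ℝ → V}
    (hu : LocallyIntegrableOn u (Ioo a b)) (hv : IntegrableOn v (Ioo a b))
    (h : ∀ φ : ℝ → ℝ, ContDiff ℝ ∞ φ → HasCompactSupport φ → tsupport φ ⊆ Ioo a b →
      ∫ s, deriv φ s • u s = -∫ s, φ s • v s) :
    ∃ c : V, ∀ᵐ s : ℝ, s ∈ Ioo a b → u s = c + ∫ r in a..s, v r := by
  set w : ℝ → V := (Ioo a b).indicator v with hw_def
  have hw : Integrable w := hv.integrable_indicator measurableSet_Ioo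
  set F : ℝ → V := fun s => ∫ r in Iic s, w r with hF
  have hFc : Continuous F := by
    have h1 : F = fun s => (∫ r in Iic 0, w r) + ∫ r in (0 : ℝ)..s, w r := by
      funext s
      rw [← intervalIntegral.integral_Iic_sub_Iic hw.integrableOn hw.integrableOn,
        add_sub_cancel]
    rw [h1]
    exact continuous_const.add
      (intervalIntegral.continuous_primitive (fun _ _ => hw.intervalIntegrable) 0)
  -- `u` and the primitive `F` have the same weak derivative on `(a, b)`, so their difference falls
  -- under du Bois-Reymond.
  have hzero : ∀ φ : ℝ → ℝ, ContDiff ℝ ∞ φ → HasCompactSupport φ → tsupport φ ⊆ Ioo a b →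
      ∫ s, deriv φ s • (u s - F s) = 0 := by
    intro φ hφ hc hs
    have hφ' : ContDiff ℝ ∞ (deriv φ) := (contDiff_infty_iff_deriv.1 hφ).2
    have h1 := integrable_deriv_smul_of_tsupport_subset hu hφ hc hs
    have h2 : Integrable fun s => deriv φ s • F s :=
      (hφ'.continuous.smul hFc).integrable_of_hasCompactSupport hc.deriv.smul_right
    simp_rw [smul_sub]
    rw [integral_sub h1 h2, h φ hφ hc hs, integral_deriv_smul_setIntegral_Iic hw hφ hc,
      sub_eq_zero]
    congr 1
    refine integral_congr_ae (Eventually.of_forall fun s => ?_)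
    by_cases hm : s ∈ Ioo a b
    · simp [hw_def, hm]
    · simp [image_eq_zero_of_notMem_tsupport fun h => hm (hs h)]
  obtain ⟨c, hc⟩ := exists_ae_eq_const_of_integral_deriv_smul_eq_zero
    (u := fun s => u s - F s) (hu.sub (hFc.locallyIntegrable.locallyIntegrableOn _))
    hzero
  refine ⟨c, ?_⟩
  filter_upwards [hc] with s hs hmem
  rw [sub_eq_iff_eq_add.1 (hs hmem)]
  congr 1
  rw [intervalIntegral.integral_of_le hmem.1.le, hF]
  dsimp only
  rw [hw_def, setIntegral_indicator measurableSet_Ioo]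
  congr 2
  ext r
  constructor
  · exact fun hr => ⟨hr.2.1, hr.1⟩
  · exact fun hr => ⟨hr.2, hr.1, hr.2.trans_lt hmem.2⟩

end WeakDerivative

/-! ### Local integrability in the memory space and testing the generator -/

section LocalIntegrability

variable {V : Type*} [NormedAddCommGroup V] {g : ℝ → ℝ} {α γ δ : ℝ}

/-- Otherwise `g` would be a nonzero constant on the half-line, contradicting summability. -/
theorem IsMemoryKernel.positivitySet_nonempty (hg : IsMemoryKernel g α γ δ) :
    (positivitySet g).Nonempty := by
  by_contra hne
  have hzero : EqOn (deriv g) 0 (Ioi 0) := fun s hs => by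
    refine le_antisymm (hg.deriv_nonpos s hs) (not_lt.1 fun h => hne ⟨s, hs, h⟩)
  obtain ⟨s₀, hs₀, hgs₀⟩ := hg.nonnull
  have hconst : EqOn g (fun _ => g s₀) (Ioi 0) := fun s hs =>
    isOpen_Ioi.is_const_of_deriv_eq_zero isPreconnected_Ioi
      (fun x hx => (hg.differentiable x hx).differentiableWithinAt) hzero hs hs₀
  have hint := (integrableOn_congr_fun hconst measurableSet_Ioi).1 hg.integrable
  rw [integrableOn_const_iff (by simp)] at hint
  simp [hgs₀] at hint

theorem IsMemoryKernel.exists_gt_mem (hg : IsMemoryKernel g α γ δ) {s : ℝ}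
    (hs : s ∈ positivitySet g) : ∃ b ∈ positivitySet g, s < b := by
  have h : ∀ᶠ b in 𝓝[>] s, b ∈ positivitySet g :=
    nhdsWithin_le_nhds (hg.isOpen_positivitySet.mem_nhds hs)
  obtain ⟨b, hb1, hb2⟩ := (h.and self_mem_nhdsWithin).exists
  exact ⟨b, hb1, hb2⟩

theorem IsMemoryKernel.ae_restrict_of_ae (hg : IsMemoryKernel g α γ δ) {b : ℝ}
    (hb : b ∈ positivitySet g) {p : ℝ → Prop} (h : ∀ᵐ s ∂memoryMeasure g, p s) :
    ∀ᵐ s ∂volume.restrict (Ioo 0 b), p s := by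
  obtain ⟨K, hK⟩ := hg.exists_restrict_le hb
  exact (Measure.absolutelyContinuous_of_le_smul hK).ae_le h

/-- The lower bound on the weight controls the unweighted `L²` norm on `(0, b)`, and Hölder on this
bounded interval gives `L¹`. A constant independent of `f` is what lets limits in `M` pass to
integrals. -/
theorem IsMemoryKernel.exists_eLpNorm_one_le (hg : IsMemoryKernel g α γ δ) {b : ℝ}
    (hb : b ∈ positivitySet g) : ∃ C : ℝ≥0∞, C ≠ ⊤ ∧ ∀ f : ℝ → V,
      AEStronglyMeasurable f (memoryMeasure g) →
      eLpNorm f 1 (volume.restrict (Ioo 0 b)) ≤ C * eLpNorm f 2 (memoryMeasure g) := by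
  obtain ⟨K, hK⟩ := hg.exists_restrict_le hb
  refine ⟨(K : ℝ≥0∞) ^ (1 / 2 : ℝ≥0∞).toReal *
    volume.restrict (Ioo 0 b) univ ^ (1 / (1 : ℝ≥0∞).toReal - 1 / (2 : ℝ≥0∞).toReal), ?_,
    fun f hf => ?_⟩
  · refine ENNReal.mul_ne_top (ENNReal.rpow_ne_top_of_nonneg ENNReal.toReal_nonneg ENNReal.coe_ne_top)
      (ENNReal.rpow_ne_top_of_nonneg (y := 1 / (1 : ℝ≥0∞).toReal - 1 / (2 : ℝ≥0∞).toReal)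
        (by norm_num) (measure_ne_top _ _))
  · have hf' := hf.mono_ac (Measure.absolutelyContinuous_of_le_smul hK)
    refine (eLpNorm_le_eLpNorm_mul_rpow_measure_univ one_le_two hf').trans ?_
    rw [mul_right_comm]
    gcongr
    exact (eLpNorm_mono_measure f hK).trans (eLpNorm_smul_measure_le _ _ _ _)

theorem IsMemoryKernel.integrableOn_Ioo (hg : IsMemoryKernel g α γ δ) {b : ℝ}
    (hb : b ∈ positivitySet g) {f : ℝ → V} (hf : MemLp f 2 (memoryMeasure g)) :
    IntegrableOn f (Ioo 0 b) := by
  obtain ⟨K, hK⟩ := hg.exists_restrict_le hb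
  obtain ⟨C, hC, h⟩ := hg.exists_eLpNorm_one_le (V := V) hb
  exact memLp_one_iff_integrable.1
    ⟨hf.1.mono_ac (Measure.absolutelyContinuous_of_le_smul hK),
      (h f hf.1).trans_lt (ENNReal.mul_lt_top hC.lt_top hf.2)⟩

theorem IsMemoryKernel.locallyIntegrableOn (hg : IsMemoryKernel g α γ δ) {f : ℝ → V}
    (hf : MemLp f 2 (memoryMeasure g)) : LocallyIntegrableOn f (positivitySet g) := by
  intro s hs
  obtain ⟨b, hb, hsb⟩ := hg.exists_gt_mem hs
  exact ⟨Ioo 0 b, nhdsWithin_le_nhds (Ioo_mem_nhds hs.1 hsb), hg.integrableOn_Ioo hb hf⟩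

theorem IsMemoryKernel.exists_tsupport_subset_Ioo (hg : IsMemoryKernel g α γ δ) {φ : ℝ → ℝ}
    (hc : HasCompactSupport φ) (hs : tsupport φ ⊆ positivitySet g) :
    ∃ b ∈ positivitySet g, tsupport φ ⊆ Ioo 0 b := by
  rcases (tsupport φ).eq_empty_or_nonempty with he | hne
  · obtain ⟨b, hb⟩ := hg.positivitySet_nonempty
    exact ⟨b, hb, by simp [he]⟩
  · obtain ⟨b, hb, hlt⟩ := hg.exists_gt_mem (hs (hc.isCompact.sSup_mem hne))
    exact ⟨b, hb, fun s hs' => ⟨(hs hs').1, (le_csSup hc.isCompact.bddAbove hs').trans_lt hlt⟩⟩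

variable [InnerProductSpace ℝ V]

theorem IsMemoryKernel.continuousOn_primitive (hg : IsMemoryKernel g α γ δ) {f : ℝ → V} {b : ℝ}
    (hb : b ∈ positivitySet g) (hf : MemLp f 2 (memoryMeasure g)) :
    ContinuousOn (fun s => ∫ r in (0 : ℝ)..s, f r) (Icc 0 b) := by
  have h : IntervalIntegrable f volume 0 b :=
    (intervalIntegrable_iff_integrableOn_Ioo_of_le hb.1.le).2 (hg.integrableOn_Ioo hb hf)
  have h2 := intervalIntegral.continuousOn_primitive_interval' h left_mem_uIcc
  rwa [uIcc_of_le hb.1.le] at h2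

theorem IsMemoryKernel.tendsto_primitive (hg : IsMemoryKernel g α γ δ) {f : ℝ → V}
    (hf : MemLp f 2 (memoryMeasure g)) :
    Tendsto (fun s => ∫ r in (0 : ℝ)..s, f r) (𝓝[>] 0) (𝓝 0) := by
  obtain ⟨b, hb⟩ := hg.positivitySet_nonempty
  have h := (hg.continuousOn_primitive hb hf) 0 (left_mem_Icc.2 hb.1.le)
  rw [ContinuousWithinAt, intervalIntegral.integral_same] at h
  refine h.mono_left (nhdsWithin_le_iff.2 ?_)
  filter_upwards [Ioo_mem_nhdsGT hb.1] with s hs using ⟨hs.1.le, hs.2.le⟩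

theorem IsMemoryKernel.tendsto_integral_smul (hg : IsMemoryKernel g α γ δ) {b : ℝ}
    (hb : b ∈ positivitySet g) {φ : ℝ → ℝ} (hφ : Continuous φ) (hc : HasCompactSupport φ)
    {ι : Type*} {l : Filter ι} {ξ : ι → MemorySpace g V} {ζ : MemorySpace g V}
    (h : Tendsto ξ l (𝓝 ζ)) :
    Tendsto (fun i => ∫ s in Ioo 0 b, φ s • ξ i s) l (𝓝 (∫ s in Ioo 0 b, φ s • ζ s)) := by
  obtain ⟨M, hM⟩ := hc.exists_bound_of_continuous hφ
  obtain ⟨C, hC, hCle⟩ := hg.exists_eLpNorm_one_le (V := V) hb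
  have hint : ∀ ξ : MemorySpace g V, IntegrableOn (fun s => φ s • ξ s) (Ioo 0 b) := fun ξ =>
    (hg.integrableOn_Ioo hb (Lp.memLp ξ)).bdd_smul M hφ.aestronglyMeasurable
      (Eventually.of_forall hM)
  refine tendsto_integral_of_L1' _ (hint ζ).aestronglyMeasurable
    (Eventually.of_forall fun i => hint (ξ i)) ?_
  have h1 := (Lp.tendsto_Lp_iff_tendsto_eLpNorm' ξ ζ).1 h
  have h2 : Tendsto (fun i => ENNReal.ofReal M * (C * eLpNorm (⇑(ξ i) - ⇑ζ) 2 (memoryMeasure g)))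
      l (𝓝 0) := by
    have := ENNReal.Tendsto.const_mul (a := ENNReal.ofReal M)
      (ENNReal.Tendsto.const_mul (a := C) h1 (Or.inr hC)) (Or.inr ENNReal.ofReal_ne_top)
    simpa using this
  refine tendsto_of_tendsto_of_tendsto_of_le_of_le tendsto_const_nhds h2 (fun _ => zero_le)
    fun i => ?_
  refine (eLpNorm_le_mul_eLpNorm_of_ae_le_mul (g := ⇑(ξ i) - ⇑ζ) (c := M)
    (Eventually.of_forall fun s => ?_) 1).trans ?_
  · rw [Pi.sub_apply, ← smul_sub, norm_smul, Pi.sub_apply]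
    exact mul_le_mul_of_nonneg_right (hM s) (norm_nonneg _)
  · gcongr
    exact hCle _ ((Lp.aestronglyMeasurable _).sub (Lp.aestronglyMeasurable _))

/-- The adjoint of right translation is left translation of the test function. The translate is zero
on `(0, t]`, so no condition on `φ` at the origin is needed. -/
theorem integral_smul_rightTranslate {t b : ℝ} (ht : 0 ≤ t) {φ : ℝ → ℝ}
    (hφ : ∀ s, b ≤ s → φ s = 0) (f : ℝ → V) :
    ∫ s in Ioo 0 b, φ s • rightTranslate t f s = ∫ s in Ioo 0 b, φ (s + t) • f s := by
  rw [← integral_indicator measurableSet_Ioo, ← integral_indicator measurableSet_Ioo,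
    ← integral_add_right_eq_self _ t]
  congr 1
  ext s
  by_cases h0 : 0 < s
  · by_cases hst : s + t < b
    · have h1 : s + t ∈ Ioo 0 b := ⟨by linarith, hst⟩
      have h2 : s ∈ Ioo 0 b := ⟨h0, by linarith⟩
      simp [h1, h2, rightTranslate, h0]
    · have h3 : φ (s + t) = 0 := hφ _ (not_lt.1 hst)
      simp [indicator_apply, h3]
  · simp [indicator_apply, rightTranslate, not_lt.1 h0, h0]

theorem tendsto_coe_nhdsGT_zero :
    Tendsto (fun t : ℝ≥0 => (t : ℝ)) (𝓝[>] 0) (𝓝[>] 0) := by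
  refine tendsto_nhdsWithin_iff.2 ⟨?_, ?_⟩
  · exact (NNReal.continuous_coe.tendsto' 0 0 rfl).mono_left nhdsWithin_le_nhds
  · filter_upwards [self_mem_nhdsWithin] with t ht using NNReal.coe_pos.2 ht

/-- The generator of the translation semigroup acts as minus the weak derivative, also against
test functions which do not vanish at the origin. -/
theorem integral_deriv_smul_eq_of_mem_generatorGraph (hg : IsMemoryKernel g α γ δ)
    {η ζ : MemorySpace g V} (h : (η, ζ) ∈ generatorGraph (translationSemigroup V hg)) {b : ℝ}
    (hb : b ∈ positivitySet g) {φ : ℝ → ℝ} (hφ : ContDiff ℝ ∞ φ) (hc : HasCompactSupport φ)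
    (hs : tsupport φ ⊆ Iio b) :
    ∫ s in Ioo 0 b, deriv φ s • η s = ∫ s in Ioo 0 b, φ s • ζ s := by
  have hφ0 : ∀ s, b ≤ s → φ s = 0 := fun s hbs =>
    image_eq_zero_of_notMem_tsupport fun h => absurd (hs h) (not_lt.2 hbs)
  have hη := hg.integrableOn_Ioo hb (Lp.memLp η)
  obtain ⟨L, hL⟩ := hφ.lipschitzWith_of_hasCompactSupport hc (by simp)
  obtain ⟨M, hM⟩ := hc.exists_bound_of_continuous hφ.continuous
  have h1 := hg.tendsto_integral_smul hb hφ.continuous hc h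
  have heq : ∀ t : ℝ≥0, ∫ s in Ioo 0 b,
      φ s • ((t : ℝ)⁻¹ • (translationSemigroup V hg t η - η) : MemorySpace g V) s
      = ∫ s in Ioo 0 b, ((t : ℝ)⁻¹ • (φ (s + t) - φ s)) • η s := by
    intro t
    have hint1 : IntegrableOn (fun s => φ s • η s) (Ioo 0 b) :=
      hη.bdd_smul M hφ.continuous.aestronglyMeasurable (Eventually.of_forall hM)
    have hint2 : IntegrableOn (fun s => φ s • translationSemigroup V hg t η s) (Ioo 0 b) :=
      (hg.integrableOn_Ioo hb (Lp.memLp _)).bdd_smul M hφ.continuous.aestronglyMeasurable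
        (Eventually.of_forall hM)
    have hint3 : IntegrableOn (fun s => φ (s + t) • η s) (Ioo 0 b) :=
      hη.bdd_smul M (hφ.continuous.comp (continuous_add_const (t : ℝ))).aestronglyMeasurable
        (Eventually.of_forall fun s => hM _)
    have e1 : ∫ s in Ioo 0 b, φ s • translationSemigroup V hg t η s
        = ∫ s in Ioo 0 b, φ (s + t) • η s := by
      rw [← integral_smul_rightTranslate t.coe_nonneg hφ0]
      refine integral_congr_ae ?_
      filter_upwards [hg.ae_restrict_of_ae hb (coeFn_translationSemigroup hg t η)] with s hs
      rw [hs]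
    have e2 : ∫ s in Ioo 0 b,
        φ s • ((t : ℝ)⁻¹ • (translationSemigroup V hg t η - η) : MemorySpace g V) s
        = ∫ s in Ioo 0 b, (t : ℝ)⁻¹ • (φ s • translationSemigroup V hg t η s - φ s • η s) := by
      refine integral_congr_ae ?_
      filter_upwards [hg.ae_restrict_of_ae hb (Lp.coeFn_smul ((t : ℝ)⁻¹)
        (translationSemigroup V hg t η - η)),
        hg.ae_restrict_of_ae hb (Lp.coeFn_sub (translationSemigroup V hg t η) η)] with s h1 h2
      rw [h1, Pi.smul_apply, h2, Pi.sub_apply, smul_comm, smul_sub]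
    rw [e2, integral_smul, integral_sub hint2 hint1, e1, ← integral_sub hint3 hint1,
      ← integral_smul]
    simp_rw [smul_assoc, sub_smul]
  simp_rw [heq] at h1
  -- The difference quotients of `φ` converge pointwise to `φ'` and are bounded by its Lipschitz
  -- constant; `η` is integrable on `(0, b)`.
  have h2 : Tendsto (fun t : ℝ≥0 => ∫ s in Ioo 0 b, ((t : ℝ)⁻¹ • (φ (s + t) - φ s)) • η s)
      (𝓝[>] 0) (𝓝 (∫ s in Ioo 0 b, deriv φ s • η s)) := by
    refine tendsto_integral_filter_of_dominated_convergence (fun s => L * ‖η s‖) ?_ ?_ ?_ ?_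
    · refine Eventually.of_forall fun t => AEStronglyMeasurable.smul ?_ hη.aestronglyMeasurable
      have := hφ.continuous
      exact Continuous.aestronglyMeasurable (by fun_prop)
    · filter_upwards [self_mem_nhdsWithin] with t ht
      have ht' : (0 : ℝ) < t := NNReal.coe_pos.2 ht
      refine Eventually.of_forall fun s => ?_
      rw [norm_smul, norm_smul]
      refine mul_le_mul_of_nonneg_right ?_ (norm_nonneg _)
      have h3 := hL.norm_sub_le (s + t) s
      rw [add_sub_cancel_left, Real.norm_of_nonneg ht'.le] at h3
      rw [norm_inv, Real.norm_of_nonneg ht'.le, inv_mul_le_iff₀ ht', mul_comm]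
      exact h3
    · exact hη.norm.const_mul _
    · refine Eventually.of_forall fun s => Tendsto.smul_const ?_ _
      have hd : HasDerivAt φ (deriv φ s) s := (hφ.differentiable (by simp) s).hasDerivAt
      exact hd.tendsto_slope_zero.comp
        (tendsto_coe_nhdsGT_zero.mono_right (nhdsWithin_mono _ fun x hx => ne_of_gt hx))
  exact tendsto_nhds_unique h2 h1

end LocalIntegrability

/-! ### The generator is contained in `T` -/

section GeneratorSubset

variable {V : Type*} [NormedAddCommGroup V] [InnerProductSpace ℝ V] {g : ℝ → ℝ} {α γ δ : ℝ}

theorem setIntegral_Ioo_eq_integral_indicator {a b : ℝ} {φ : ℝ → ℝ}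
    (hs : tsupport φ ⊆ Ioo a b) (f : ℝ → V) :
    ∫ s in Ioo 0 b, φ s • f s = ∫ s, φ s • (Ioi 0).indicator f s := by
  rw [← integral_indicator measurableSet_Ioo]
  congr 1
  ext s
  by_cases hm : s ∈ Ioo a b
  · by_cases h0 : 0 < s
    · simp [h0, hm.2]
    · simp [h0]
  · have h0 : φ s = 0 := image_eq_zero_of_notMem_tsupport fun h => hm (hs h)
    simp [indicator_apply, h0]

theorem intervalIntegral_indicator_Ioi {a s : ℝ} (ha : a ≤ 0) (hs : 0 ≤ s) (f : ℝ → V) :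
    ∫ r in a..s, (Ioi 0).indicator f r = ∫ r in (0 : ℝ)..s, f r := by
  rw [intervalIntegral.integral_of_le (ha.trans hs), intervalIntegral.integral_of_le hs,
    setIntegral_indicator measurableSet_Ioi]
  congr 2
  ext r
  constructor
  · exact fun h => ⟨h.2, h.1.2⟩
  · exact fun h => ⟨⟨ha.trans_lt h.1, h.2⟩, h.1⟩

/-- Elements of the domain of the generator are primitives vanishing at the origin. -/
theorem ae_eq_neg_primitive_of_mem_generatorGraph [CompleteSpace V]
    (hg : IsMemoryKernel g α γ δ) {η ζ : MemorySpace g V}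
    (h : (η, ζ) ∈ generatorGraph (translationSemigroup V hg)) :
    ∀ᵐ s ∂memoryMeasure g, η s = -∫ r in (0 : ℝ)..s, ζ r := by
  rw [ae_memoryMeasure_iff]
  refine ae_of_mem_of_ae_of_mem_inter_Ioo fun a b ha hb hab => ?_
  have hind : ∀ ξ : MemorySpace g V, IntegrableOn ((Ioi 0).indicator ξ) (Ioo (-1) b) := by
    intro ξ
    rw [integrableOn_indicator_iff measurableSet_Ioi]
    exact (hg.integrableOn_Ioo hb (Lp.memLp ξ)).mono_set fun s hs => ⟨hs.1, hs.2.2⟩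
  -- Working on `(-1, b)` with extensions by zero encodes the boundary condition: the test functions
  -- now include some that do not vanish at the origin.
  obtain ⟨c, hc⟩ := exists_ae_eq_const_add_setIntegral (V := V)
    (u := (Ioi 0).indicator η) (v := fun s => -(Ioi 0).indicator ζ s)
    (hind η).locallyIntegrableOn (hind ζ).neg fun φ hφ hφc hs => by
      have hs' : tsupport (deriv φ) ⊆ Ioo (-1) b :=
        (closure_mono (support_deriv_subset (f := φ))).trans
          (by rw [(isClosed_tsupport φ).closure_eq]; exact hs)
      simp_rw [smul_neg]
      rw [integral_neg, neg_neg, ← setIntegral_Ioo_eq_integral_indicator hs,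
        ← setIntegral_Ioo_eq_integral_indicator hs']
      exact integral_deriv_smul_eq_of_mem_generatorGraph hg h hb hφ hφc
        (hs.trans Ioo_subset_Iio_self)
  -- On `(-1, 0)`, a set of positive measure, both the extended function and the primitive vanish.
  have hc0 : c = 0 := by
    have hpos : ∃ᵐ s : ℝ, s ∈ Ioo (-1 : ℝ) 0 := by
      rw [frequently_ae_iff]
      change volume (Ioo (-1 : ℝ) 0) ≠ 0
      simp
    obtain ⟨s, hs, hs'⟩ := (hpos.and_eventually hc).exists
    have h1 := hs' ⟨hs.1, hs.2.trans hb.1⟩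
    have h2 : ∫ r in (-1 : ℝ)..s, -(Ioi 0).indicator ζ r = 0 := by
      refine intervalIntegral.integral_zero_ae (Eventually.of_forall fun r hr => ?_)
      rw [uIoc_of_le hs.1.le] at hr
      simp [(hr.2.trans_lt hs.2).le]
    rw [h2, indicator_of_notMem (by simpa using hs.2.le), add_zero] at h1
    exact h1.symm
  filter_upwards [hc] with s hs hmem
  have hs0 : 0 < s := hmem.1.1
  have h1 := hs ⟨by linarith, hmem.2.2⟩
  rw [hc0, zero_add, intervalIntegral.integral_neg,
    intervalIntegral_indicator_Ioi (by norm_num) hs0.le, indicator_of_mem (mem_Ioi.2 hs0)] at h1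
  exact h1

/-- The primitive `-∫₀ˢ ζ` serves as the continuous representative with limit zero at the origin,
and its weak derivative is `-ζ` by the tested identity. -/
theorem generatorGraph_le_translationGraph [CompleteSpace V] (hg : IsMemoryKernel g α γ δ) :
    generatorGraph (translationSemigroup V hg) ≤ translationGraph g V := by
  rintro ⟨η, ζ⟩ h
  have hae := ae_eq_neg_primitive_of_mem_generatorGraph hg h
  have hmem : MemLp (fun s => -∫ r in (0 : ℝ)..s, ζ r) 2 (memoryMeasure g) :=
    (memLp_congr_ae hae).1 (Lp.memLp η)
  refine ⟨fun s => -∫ r in (0 : ℝ)..s, ζ r, fun s => -ζ s, EventuallyEq.symm hae,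
    Eventually.of_forall fun s => neg_neg _, ⟨hg.locallyIntegrableOn hmem,
    hg.locallyIntegrableOn (Lp.memLp ζ).neg, fun φ hφ hc hs => ?_⟩, fun s hs => ?_, ?_⟩
  · obtain ⟨b, hb, hsb⟩ := hg.exists_tsupport_subset_Ioo hc hs
    have hzero : ∀ s, s ∉ Ioo 0 b → φ s = 0 := fun s hs' =>
      image_eq_zero_of_notMem_tsupport fun h => hs' (hsb h)
    have hzero' : ∀ s, s ∉ Ioo 0 b → deriv φ s = 0 := fun s hs' => by
      by_contra hne
      exact hs' (hsb (support_deriv_subset hne))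
    have h1 := integral_deriv_smul_eq_of_mem_generatorGraph hg h hb hφ hc
      (hsb.trans Ioo_subset_Iio_self)
    have e1 : ∫ s in Ioo 0 b, deriv φ s • -∫ r in (0 : ℝ)..s, ζ r
        = ∫ s, deriv φ s • -∫ r in (0 : ℝ)..s, ζ r :=
      setIntegral_eq_integral_of_forall_compl_eq_zero fun s hs' => by
        rw [hzero' s hs', zero_smul]
    have e2 : ∫ s in Ioo 0 b, φ s • -ζ s = ∫ s, φ s • -ζ s :=
      setIntegral_eq_integral_of_forall_compl_eq_zero fun s hs' => by
        rw [hzero s hs', zero_smul]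
    rw [← e1, ← e2]
    simp_rw [smul_neg]
    rw [integral_neg, integral_neg, neg_neg, ← h1, ← integral_neg]
    refine integral_congr_ae ?_
    filter_upwards [hg.ae_restrict_of_ae hb hae] with s hs'
    rw [hs', smul_neg]
  · obtain ⟨b, hb, hsb⟩ := hg.exists_gt_mem hs
    exact ((hg.continuousOn_primitive hb (Lp.memLp ζ)).continuousAt
      (Icc_mem_nhds hs.1 hsb)).neg.continuousWithinAt
  · simpa using (hg.tendsto_primitive (Lp.memLp ζ)).neg

end GeneratorSubset

/-! ### `T` is contained in the generator -/

section TranslationGraphSubset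

variable {V : Type*} [NormedAddCommGroup V] [InnerProductSpace ℝ V] {g : ℝ → ℝ} {α γ δ : ℝ}

theorem frequently_nhdsGT_of_ae {b : ℝ} (hb : 0 < b) {p : ℝ → Prop}
    (h : ∀ᵐ s : ℝ, s ∈ Ioo 0 b → p s) : ∃ᶠ s in 𝓝[>] (0 : ℝ), p s := by
  intro hn
  obtain ⟨u, hu, hsub⟩ := mem_nhdsGT_iff_exists_Ioo_subset.1 hn
  have hpos : ∃ᵐ s : ℝ, s ∈ Ioo 0 (min u b) := by
    rw [frequently_ae_iff]
    change volume (Ioo (0 : ℝ) (min u b)) ≠ 0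
    have hu' : 0 < u := hu
    simp [hu', hb]
  obtain ⟨s, hs, hs'⟩ := (hpos.and_eventually h).exists
  exact hsub ⟨hs.1, hs.2.trans_le (min_le_left _ _)⟩
    (hs' ⟨hs.1, hs.2.trans_le (min_le_right _ _)⟩)

/-- Elements of the domain of `T` are primitives vanishing at the origin. -/
theorem ae_eq_neg_primitive_of_mem_translationGraph [CompleteSpace V]
    (hg : IsMemoryKernel g α γ δ) {η ζ : MemorySpace g V} (h : (η, ζ) ∈ translationGraph g V) :
    ∀ᵐ s ∂memoryMeasure g, η s = -∫ r in (0 : ℝ)..s, ζ r := by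
  obtain ⟨f, f', h1, h2, h3, -, h5⟩ := h
  have hfm : MemLp f 2 (memoryMeasure g) := (memLp_congr_ae h1).2 (Lp.memLp η)
  have hfm' : MemLp f' 2 (memoryMeasure g) := by
    have h := ((memLp_congr_ae h2).2 (Lp.memLp ζ)).neg
    rwa [show (-fun s => -f' s) = f' from funext fun s => neg_neg _] at h
  rw [ae_memoryMeasure_iff]
  refine ae_of_mem_of_ae_of_mem_inter_Ioo fun a b ha hb hab => ?_
  have hsub : Ioo 0 b ⊆ positivitySet g := fun s hs =>
    hg.mem_positivitySet_of_le hs.1 hs.2.le hb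
  obtain ⟨c, hc⟩ := exists_ae_eq_const_add_setIntegral (V := V)
    (hg.integrableOn_Ioo hb hfm).locallyIntegrableOn (hg.integrableOn_Ioo hb hfm')
    fun φ hφ hφc hs => h3.integral_eq φ hφ hφc (hs.trans hsub)
  -- `f - ∫₀ˢ f'` tends to zero at the origin, yet equals `c` at points arbitrarily close to it.
  have hc0 : c = 0 := by
    by_contra hne
    have hlim := h5.sub (hg.tendsto_primitive hfm')
    rw [sub_zero] at hlim
    refine frequently_nhdsGT_of_ae hb.1 hc ?_
    filter_upwards [hlim.eventually_ne (Ne.symm hne)] with s hs hs'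
    exact hs (sub_eq_iff_eq_add.2 hs')
  have h1' := (ae_restrict_iff' measurableSet_Ioo).1 (hg.ae_restrict_of_ae hb h1)
  have h2' := (ae_restrict_iff' measurableSet_Ioo).1 (hg.ae_restrict_of_ae hb h2)
  filter_upwards [hc, h1'] with s hs hs1 hmem
  have hmem' : s ∈ Ioo 0 b := ⟨hmem.1.1, hmem.2.2⟩
  rw [← hs1 hmem', hs hmem', hc0, zero_add, ← intervalIntegral.integral_neg]
  refine intervalIntegral.integral_congr_ae ?_
  filter_upwards [h2'] with r hr hr'
  rw [uIoc_of_le hmem'.1.le] at hr'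
  rw [← hr ⟨hr'.1, hr'.2.trans_lt hmem'.2⟩, neg_neg]

/-- The difference between a right translate of a primitive and the primitive is an average of
translates. -/
theorem rightTranslate_neg_primitive_sub {z : ℝ → V} {b s t : ℝ} (hz : IntegrableOn z (Ioo 0 b))
    (hs : 0 < s) (hsb : s < b) (ht : 0 ≤ t) :
    rightTranslate t (fun x => -∫ r in (0 : ℝ)..x, z r) s - -∫ r in (0 : ℝ)..s, z r
      = ∫ r in (0 : ℝ)..t, rightTranslate r z s := by
  have hz0 : IntegrableOn ((Ioi 0).indicator z) (Iio b) := by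
    rw [integrableOn_indicator_iff measurableSet_Ioi]
    exact hz
  have hint : ∀ x y : ℝ, x < b → y < b → IntervalIntegrable ((Ioi 0).indicator z) volume x y := by
    intro x y hx hy
    exact intervalIntegrable_iff.2 (hz0.mono_set fun r hr => hr.2.trans_lt (max_lt hx hy))
  simp_rw [rightTranslate_eq_indicator_sub z s]
  rw [intervalIntegral.integral_comp_sub_left (fun r => (Ioi 0).indicator z r), sub_zero,
    ← intervalIntegral.integral_interval_sub_left (hint 0 s (hs.trans hsb) hsb)
      (hint 0 (s - t) (hs.trans hsb) (by linarith)),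
    intervalIntegral_indicator_Ioi le_rfl hs.le, sub_neg_eq_add, add_comm, sub_eq_add_neg]
  congr 1
  -- If `s ≤ t`, the remaining integral lies over nonpositive `r`, where the extension of `z` by
  -- zero vanishes.
  by_cases hst : s ≤ t
  · rw [rightTranslate, if_pos hst, eq_comm, neg_eq_zero]
    refine intervalIntegral.integral_zero_ae (Eventually.of_forall fun r hr => ?_)
    rw [uIoc_of_ge (by linarith)] at hr
    simp [hr.2]
  · rw [rightTranslate, if_neg hst, intervalIntegral_indicator_Ioi le_rfl (by linarith)]

/-- Jensen's inequality for the mean over `(0, t]`. -/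
theorem enorm_sq_inv_smul_integral_le {t : ℝ≥0} (ht : t ≠ 0) {h : ℝ → V}
    (hh : AEStronglyMeasurable h (volume.restrict (Ioc 0 (t : ℝ)))) :
    ‖(t : ℝ)⁻¹ • ∫ r in (0 : ℝ)..t, h r‖ₑ ^ 2
      ≤ (t : ℝ≥0∞)⁻¹ * ∫⁻ r in Ioc 0 (t : ℝ), ‖h r‖ₑ ^ 2 := by
  have ht0 : (t : ℝ≥0∞) ≠ 0 := by simpa using ht
  have hnorm : ‖(t : ℝ)⁻¹‖ₑ = (t : ℝ≥0∞)⁻¹ := by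
    rw [← NNReal.coe_inv, ← ENNReal.coe_inv ht, Real.enorm_of_nonneg (t⁻¹).coe_nonneg,
      ENNReal.ofReal_coe_nnreal]
  have hCS : (∫⁻ r in Ioc 0 (t : ℝ), ‖h r‖ₑ) ^ 2
      ≤ (∫⁻ r in Ioc 0 (t : ℝ), ‖h r‖ₑ ^ 2) * t := by
    have h1 := eLpNorm_le_eLpNorm_mul_rpow_measure_univ (p := 1) (q := 2) one_le_two hh
    have h2 := pow_le_pow_left₀ (zero_le) h1 2
    rw [eLpNorm_one_eq_lintegral_enorm, mul_pow, eLpNorm_two_sq] at h2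
    refine h2.trans_eq ?_
    congr 1
    rw [Measure.restrict_apply_univ, Real.volume_Ioc, sub_zero, ENNReal.ofReal_coe_nnreal,
      ← ENNReal.rpow_natCast, ← ENNReal.rpow_mul]
    norm_num
  rw [enorm_smul, hnorm, intervalIntegral.integral_of_le t.coe_nonneg, mul_pow]
  calc (t : ℝ≥0∞)⁻¹ ^ 2 * ‖∫ r in Ioc 0 (t : ℝ), h r‖ₑ ^ 2
      ≤ (t : ℝ≥0∞)⁻¹ ^ 2 * ((∫⁻ r in Ioc 0 (t : ℝ), ‖h r‖ₑ ^ 2) * t) := by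
        gcongr
        refine (pow_le_pow_left₀ (zero_le) (enorm_integral_le_lintegral_enorm h) 2).trans hCS
    _ = (t : ℝ≥0∞)⁻¹ * ((t : ℝ≥0∞)⁻¹ * t) * ∫⁻ r in Ioc 0 (t : ℝ), ‖h r‖ₑ ^ 2 := by ring
    _ = _ := by rw [ENNReal.inv_mul_cancel ht0 ENNReal.coe_ne_top, mul_one]

/-- The slope minus `ζ` is the mean of `R(r)ζ - ζ` over `0 < r ≤ t`. Jensen pointwise in `s`, then
Tonelli, bound its squared norm by the mean of the squared norms, each at most `ε²`. -/
theorem eLpNorm_slope_sub_le [CompleteSpace V] (hg : IsMemoryKernel g α γ δ)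
    {η ζ : MemorySpace g V}
    (hη : ∀ᵐ s ∂memoryMeasure g, η s = -∫ r in (0 : ℝ)..s, ζ r) {t : ℝ≥0} (ht : t ≠ 0)
    {ε : ℝ≥0∞} (hε : ∀ r : ℝ≥0, r ≤ t →
      eLpNorm (⇑(translationSemigroup V hg r ζ) - ⇑ζ) 2 (memoryMeasure g) ≤ ε) :
    eLpNorm (⇑((t : ℝ)⁻¹ • (translationSemigroup V hg t η - η)) - ⇑ζ) 2 (memoryMeasure g)
      ≤ ε := by
  have := hg.isFiniteMeasure
  have ht0 : (t : ℝ≥0∞) ≠ 0 := by simpa using ht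
  have ht' : (t : ℝ) ≠ 0 := by simpa using ht
  have hζm : StronglyMeasurable ζ := Lp.stronglyMeasurable ζ
  -- Tonelli needs measurability in `(s, r)` jointly, obtained by composing the extension of `ζ` by
  -- zero with `s - r`.
  have hjoint : StronglyMeasurable fun p : ℝ × ℝ => rightTranslate p.2 ζ p.1 - ζ p.1 := by
    have h1 : StronglyMeasurable fun p : ℝ × ℝ => (Ioi 0).indicator ζ (p.1 - p.2) :=
      (hζm.indicator measurableSet_Ioi).comp_measurable (measurable_fst.sub measurable_snd)
    simp_rw [← rightTranslate_eq_indicator_sub] at h1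
    exact h1.sub (hζm.comp_measurable measurable_fst)
  have hpt : ∀ᵐ s ∂memoryMeasure g,
      ((t : ℝ)⁻¹ • (translationSemigroup V hg t η - η) : MemorySpace g V) s - ζ s
        = (t : ℝ)⁻¹ • ∫ r in (0 : ℝ)..t, (rightTranslate r ζ s - ζ s) := by
    have hP : ∀ᵐ s ∂memoryMeasure g, s ∈ positivitySet g :=
      (ae_memoryMeasure_iff g _).2 (Eventually.of_forall fun s hs => hs)
    filter_upwards [hP, hη, Lp.coeFn_smul ((t : ℝ)⁻¹) (translationSemigroup V hg t η - η),
      Lp.coeFn_sub (translationSemigroup V hg t η) η, coeFn_translationSemigroup hg t η,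
      hg.rightTranslate_congr t.coe_nonneg hη] with s h0 h1 h2 h3 h4 h5
    obtain ⟨b, hb, hsb⟩ := hg.exists_gt_mem h0
    have hζb := hg.integrableOn_Ioo hb (Lp.memLp ζ)
    have hint : IntervalIntegrable (fun r => rightTranslate r ζ s) volume 0 t := by
      have hz0 : IntegrableOn ((Ioi 0).indicator ζ) (Iio b) := by
        rw [integrableOn_indicator_iff measurableSet_Ioi]
        exact hζb
      have hii : IntervalIntegrable ((Ioi 0).indicator ζ) volume (s - 0) (s - t) :=
        intervalIntegrable_iff.2 (hz0.mono_set fun r hr => hr.2.trans_lt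
          (max_lt (by linarith) (by linarith [t.coe_nonneg])))
      have := (hii.comp_sub_left s)
      simp_rw [rightTranslate_eq_indicator_sub]
      simpa using this
    rw [h2, Pi.smul_apply, h3, Pi.sub_apply, h4, h5, h1,
      rightTranslate_neg_primitive_sub hζb h0.1 hsb t.coe_nonneg,
      intervalIntegral.integral_sub hint intervalIntegrable_const, smul_sub,
      intervalIntegral.integral_const, sub_zero, smul_smul, inv_mul_cancel₀ ht', one_smul]
  have hsq : ∫⁻ s, ‖((t : ℝ)⁻¹ • (translationSemigroup V hg t η - η) : MemorySpace g V) s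
      - ζ s‖ₑ ^ 2 ∂memoryMeasure g ≤ ε ^ 2 := by
    calc _ ≤ ∫⁻ s, ((t : ℝ≥0∞)⁻¹ * ∫⁻ r in Ioc 0 (t : ℝ), ‖rightTranslate r ζ s - ζ s‖ₑ ^ 2)
          ∂memoryMeasure g := by
          refine lintegral_mono_ae ?_
          filter_upwards [hpt] with s hs
          rw [hs]
          exact enorm_sq_inv_smul_integral_le ht
            (hjoint.comp_measurable measurable_prodMk_left).aestronglyMeasurable
      _ = (t : ℝ≥0∞)⁻¹ * ∫⁻ r in Ioc 0 (t : ℝ), ∫⁻ s, ‖rightTranslate r ζ s - ζ s‖ₑ ^ 2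
          ∂memoryMeasure g := by
          rw [lintegral_const_mul' _ _ (ENNReal.inv_ne_top.2 ht0)]
          congr 1
          exact lintegral_lintegral_swap (f := fun s r => ‖rightTranslate r ζ s - ζ s‖ₑ ^ 2)
            (hjoint.enorm.pow_const 2).aemeasurable
      _ ≤ (t : ℝ≥0∞)⁻¹ * ∫⁻ _ in Ioc 0 (t : ℝ), ε ^ 2 := by
          refine mul_le_mul_right ?_ _
          refine setLIntegral_mono measurable_const fun r hr => ?_
          have h1 := hε ⟨r, hr.1.le⟩ hr.2
          rw [eLpNorm_congr_ae ((coeFn_translationSemigroup hg ⟨r, hr.1.le⟩ ζ).sub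
            EventuallyEq.rfl)] at h1
          have h2 := pow_le_pow_left₀ (zero_le) h1 2
          rwa [eLpNorm_two_sq] at h2
      _ = ε ^ 2 := by
          rw [setLIntegral_const, Real.volume_Ioc, sub_zero, ENNReal.ofReal_coe_nnreal, mul_comm,
            mul_assoc, ENNReal.mul_inv_cancel ht0 ENNReal.coe_ne_top, mul_one]
  refine (ENNReal.pow_le_pow_left_iff two_ne_zero).1 ?_
  rw [eLpNorm_two_sq]
  exact hsq

/-- Strong continuity at zero, applied to `ζ`, makes the averaged error small uniformly for `r ≤ t`.
-/
theorem translationGraph_le_generatorGraph [CompleteSpace V] (hg : IsMemoryKernel g α γ δ) :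
    translationGraph g V ≤ generatorGraph (translationSemigroup V hg) := by
  rintro ⟨η, ζ⟩ h
  have hη := ae_eq_neg_primitive_of_mem_translationGraph hg h
  change Tendsto (fun t : ℝ≥0 => (t : ℝ)⁻¹ • (translationSemigroup V hg t η - η)) (𝓝[>] 0) (𝓝 ζ)
  rw [Lp.tendsto_Lp_iff_tendsto_eLpNorm', ENNReal.tendsto_nhds_zero]
  intro ε hε
  have hcont := ((isC0Semigroup_translationSemigroup (V := V) hg).continuous ζ).tendsto 0
  rw [translationSemigroup_zero hg, ContinuousLinearMap.id_apply,
    Lp.tendsto_Lp_iff_tendsto_eLpNorm', ENNReal.tendsto_nhds_zero] at hcont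
  obtain ⟨τ, hτ, hτle⟩ := Metric.eventually_nhds_iff.1 (hcont ε hε)
  have hsmall : ∀ᶠ t : ℝ≥0 in 𝓝[>] 0, dist t 0 < τ :=
    nhdsWithin_le_nhds (Metric.ball_mem_nhds 0 hτ)
  filter_upwards [hsmall, self_mem_nhdsWithin] with t ht ht0
  refine eLpNorm_slope_sub_le hg hη (ne_of_gt ht0) fun r hr => hτle (lt_of_le_of_lt ?_ ht)
  simpa [NNReal.dist_eq] using hr

end TranslationGraphSubset

theorem infinitesimalGenerator_translationSemigroup {V : Type*} [NormedAddCommGroup V]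
    [InnerProductSpace ℝ V] [CompleteSpace V] {g : ℝ → ℝ} {α γ δ : ℝ}
    (hg : IsMemoryKernel g α γ δ) :
    infinitesimalGenerator (translationSemigroup V hg) = translationOperator g V := by
  refine LinearPMap.eq_of_eq_graph ?_
  rw [graph_infinitesimalGenerator, graph_translationOperator hg]
  exact le_antisymm (generatorGraph_le_translationGraph hg) (translationGraph_le_generatorGraph hg)


theorem theorem5p2 {H : Type*} [NormedAddCommGroup H] [InnerProductSpace ℝ H] [CompleteSpace H]
    {A B : H →ₗ.[ℝ] H} (hA : IsStrictlyPositiveOperator A) (hB : IsPositiveSqrt A B)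
    {g : ℝ → ℝ} {α γ δ : ℝ} (hg : IsMemoryKernel g α γ δ) :
    ∃ R : ℝ≥0 → MemorySpace g (EnergySpace hA hB) →L[ℝ] MemorySpace g (EnergySpace hA hB),
      (∀ (t : ℝ≥0) (η : MemorySpace g (EnergySpace hA hB)),
        R t η =ᵐ[memoryMeasure g] rightTranslate (t : ℝ) η) ∧
      IsC0Semigroup R ∧
      infinitesimalGenerator R = translationOperator g (EnergySpace hA hB) ∧
      IsContractionSemigroup fun t : ℝ≥0 => Real.exp (-((α - δ) * (t : ℝ) / 2)) • R t := by
  exact ⟨translationSemigroup _ hg, coeFn_translationSemigroup hg,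
    isC0Semigroup_translationSemigroup hg, infinitesimalGenerator_translationSemigroup hg,
    isContractionSemigroup_translationSemigroup hg⟩
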